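/- **Setting.** There are $N$ agents with positions $q_i(t)\in\mathbb R^n$ and Euler–Lagrange dynamics $$M_i(q_i)\ddot q_i+C_i(q_i,\dot q_i)\dot q_i+g_i(q_i)=f_i=\mathrm{Sat}_{\bar f_i}(\hat f_i),$$ where $\mathrm{Sat}_b$ is the componentwise saturation $x^k\mapsto\max(-b^k,\min(b^k,x^k))$. Here $M_i$ is differentiable and symmetric with $\lambda_{i1}I\preceq M_i(q)\preceq\lambda_{i2}I$, $\lambda_{i1}>0$; $\dot M_i-2C_i$ is skew-symmetric; $\|C_i(q,\dot q)y\|\le c_i\|\dot q\|\|y\|$ for some $c_i>0$; and $M_i(q)a+C_i(q,\dot q)w+g_i(q)=\Phi_i(q,\dot q,w,a)\theta_i$ for all $q,\dot q,w,a$, with a constant unknown parameter vector $\theta_i\in\mathbb R^{m_i}$. The initial communication graph $\mathcal E(0)$ is undirected and connected, with neighbour sets $\mathcal N_i$; $r>0$ is the communication radius, and $\|q_i(0)-q_j(0)\|\le r-\epsilon$ on every edge for some $\epsilon>0$. Put $\hat r=r-\frac{2\epsilon}{3}$. The agents start at rest. The delays satisfy $0\le T_{ij}(t)\le\overline T_{ij}$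 for $t\ge0$ on every edge. **Control.** Agent $i$ has a proxy at $\hat q_i$, with $\hat q_i(t)=q_i(0)$ for $t\le 0$ and $\dot{\hat q}_i(0)=0$. Let $\tilde q_i=q_i-\hat q_i$, $e_i=p_i\tilde q_i$, $s_i=\dot q_i+\alpha e_i$, $\Phi_i=\Phi_i(q_i,\dot q_i,-\alpha e_i,-\alpha\dot e_i)$, $b_i=\bar f_i-\eta_i$ and $\hat q_{jd}(t)=\hat q_j(t-T_{ji}(t))$. The control is $$\hat f_i=\Phi_i\hat\theta_i-\mathrm{Sat}_{b_i}(\mu_is_i+e_i),\qquad \dot{\hat\theta}_i=\mathrm{Proj}_{\hat\theta_i}(\omega_i),\qquad \omega_i=-\beta_i\Phi_i^{\mathsf T}s_i,$$ $$\ddot{\hat q}_i=\mathrm{Sat}_{b_i}(e_i)-\sum_{j\in\mathcal N_i}\nabla_i\psi(\|\hat q_i-\hat q_{jd}\|)-k_i\dot{\hat q}_i,$$ with positive constants $p_i,\mu_i,\beta_i,k_i,\alpha$. Componentwise, with $0<\delta<\frac12(\overline\theta_i^k-\underline\theta_i^k)$, $\mathrm{Proj}$ equals $\bigl(1-\min(1,\frac{\underline\theta_i^k+\delta-\hat\theta_i^k}{\delta})\bigr)\omega_i^k$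 if $\hat\theta_i^k\le\underline\theta_i^k+\delta$ and $\omega_i^k<0$; $\bigl(1-\min(1,\frac{\hat\theta_i^k-\overline\theta_i^k+\delta}{\delta})\bigr)\omega_i^k$ if $\hat\theta_i^k\ge\overline\theta_i^k-\delta$ and $\omega_i^k>0$; and $\omega_i^k$ otherwise. Initially $\underline\theta_i\le\hat\theta_i(0)\le\overline\theta_i$, and the true parameters satisfy $\underline\theta_i^k+\delta\le\theta_i^k\le\overline\theta_i^k-\delta$. Let $\phi_i(x)=\sum_k\int_0^{x^k}\mathrm{sat}_{b_i^k}(p_i\sigma)\,d\sigma$, where $\mathrm{sat}_b(y)=\max(-b,\min(b,y))$, and let $\phi^*=\min_i\min_{\|x\|=\epsilon/3}\phi_i(x)$. **Assumptions.** 1. *(Actuation.)* There are constants $v_i^k\ge\sqrt{2\phi^*/\lambda_{i1}}+\alpha p_i\frac{\epsilon}{3}$ and $\hat v_i^k\ge\sqrt{2\phi^*}$ such that the dynamic compensation satisfies $|(\Phi_i\hat\theta_i)^k|\le\eta_i^k$ whenever $\|\tilde q_i\|\le\frac{\epsilon}{3}$, $|\dot q_i^l|\le v_i^l$ and $|\dot{\hat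 q}_i^l|\le\hat v_i^l$ for all $l$, and $\underline\theta_i\le\hat\theta_i\le\overline\theta_i$. Moreover $\eta_i^k<\bar f_i^k$. 2. *(Potential.)* Let $D\ge\hat r$ and $D\ge\hat r+\overline T_{ij}\sqrt{2\phi^*}$ for every edge. On $[0,\hat r]$, $\psi\ge0$, $\psi(d)=0$ iff $d=0$, and $\partial\psi/\partial(d^2)>0$; this derivative exists on $[0,D]$. Put $\Psi_{\max}=\psi(\hat r)$, and assume $\Psi_{\max}\le\phi^*$. 3. *(Gradient.)* There are $\zeta,\vartheta>0$ such that, for all $x_i,x_j,x_{jd}\in\mathbb R^n$ with $\|x_i-x_j\|\le\hat r$ and $\|x_i-x_{jd}\|\le D$, and for all $k$, $$\bigl|\nabla_i^k\psi(\|x_i-x_j\|)-\nabla_i^k\psi(\|x_i-x_{jd}\|)\bigr|\le\zeta|x_j^k-x_{jd}^k|+\vartheta\|x_j-x_{jd}\|_\infty .$$ 4. *(Initial energy.)* $\displaystyle\sum_i\frac{1}{2\beta_i}\|\theta_i-\hat\theta_i(0)\|^2<\Psi_{\max}-\frac12\sum_i\sum_{j\in\mathcal N_i}\psi(\|q_i(0)-q_j(0)\|)$.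 5. *(Proxy damping.)* For some $a>0$ and $\upsilon_i>0$, $$k_i\ge\sum_{j\in\mathcal N_i}\Bigl(\frac{a(\zeta+\vartheta)}{2}+\frac{(\zeta+n\vartheta)\overline T_{ij}^2}{2a}\Bigr)+\upsilon_i .$$ **Conclusion.** Along every solution of the closed loop on $[0,\infty)$, for all $t\ge0$: $\underline\theta_i\le\hat\theta_i(t)\le\overline\theta_i$; $|\hat f_i^k(t)|\le\bar f_i^k$, so that the actuators never saturate; $\|q_i(t)-\hat q_i(t)\|<\frac{\epsilon}{3}$ for every $i$; and $\|\hat q_i(t)-\hat q_j(t)\|<\hat r$ and $\|q_i(t)-q_j(t)\|<r$ for every edge $(i,j)\in\mathcal E(0)$, so that the initial connectivity is preserved. As $t\to\infty$, $q_i-\hat q_i\to0$ and $\dot{\hat q}_i\to0$ for all $i$, and $q_i-q_j\to0$ for all $i,j$, so that consensus is reached. The control of agent $i$ uses no velocities of its neighbours. -/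

import Mathlib

open Filter Topology Set

noncomputable section

/-- `ℝⁿ` with the Euclidean norm. -/
abbrev Vec (n : ℕ) : Type := EuclideanSpace ℝ (Fin n)

/-- The data of an Euler-Lagrange agent `M(q) q̈ + C(q, q̇) q̇ + g(q) = f` in `ℝⁿ` with `m` constant
parameters: inertia, Coriolis and centrifugal effects, gravity, the regressor `Φ` (a matrix valued
function of position, velocity, reference velocity, reference acceleration), the true parameter
vector `θ`, and the maximum actuation in each coordinate. -/
structure ELAgent (n m : ℕ) where
  M : Vec n → Vec n →L[ℝ] Vec n
  C : Vec n → Vec n → Vec n →L[ℝ] Vec n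
  g : Vec n → Vec n
  Φ : Vec n → Vec n → Vec n → Vec n → Vec m →L[ℝ] Vec n
  θ : Vec m
  fmax : Fin n → ℝ

/-- The standard properties of Euler-Lagrange dynamics. -/
structure ELAgent.IsEulerLagrange {n m : ℕ} (A : ELAgent n m) (lam₁ lam₂ : ℝ) : Prop where
  lam₁_pos : 0 < lam₁
  inertia_symm : ∀ q x y, inner ℝ (A.M q x) y = inner ℝ x (A.M q y)
  inertia_lower : ∀ q x, lam₁ * ‖x‖ ^ 2 ≤ inner ℝ (A.M q x) x
  inertia_upper : ∀ q x, inner ℝ (A.M q x) x ≤ lam₂ * ‖x‖ ^ 2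
  inertia_diff : Differentiable ℝ A.M
  /-- `Ṁ - 2 C` is skew-symmetric; `Ṁ` is the derivative of `M` along the velocity `v`. -/
  skew : ∀ q v x y, inner ℝ ((fderiv ℝ A.M q v - (2 : ℝ) • A.C q v) x) y
    = - inner ℝ x ((fderiv ℝ A.M q v - (2 : ℝ) • A.C q v) y)
  coriolis_bound : ∃ c > 0, ∀ q v y, ‖A.C q v y‖ ≤ c * ‖v‖ * ‖y‖
  /-- Linear parameterization: `w` is the reference velocity, `a` the reference acceleration. -/
  linear_param : ∀ q v w a, A.M q a + A.C q v w + A.g q = A.Φ q v w a A.θ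

/-- The standard scalar saturation with bounds `±b`. -/
def sat (b x : ℝ) : ℝ := max (-b) (min b x)

/-- The componentwise saturation with bounds `±b k`. -/
def Sat {n : ℕ} (b : Fin n → ℝ) (x : Vec n) : Vec n := WithLp.toLp 2 fun k => sat (b k) (x k)

/-- The potential energy `∫₀ˣ Sat (p σ) dσ` of a saturated agent-proxy coupling. -/
def couplingEnergy {n : ℕ} (b : Fin n → ℝ) (p : ℝ) (x : Vec n) : ℝ :=
  ∑ k, ∫ σ in (0 : ℝ)..x k, sat (b k) (p * σ)

/-- The minimum of the coupling energy on the sphere of radius `ρ` around the origin. -/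
def couplingEnergyMin {n : ℕ} (b : Fin n → ℝ) (p ρ : ℝ) : ℝ :=
  sInf (couplingEnergy b p '' Metric.sphere (0 : Vec n) ρ)

/-- One component of the projection operator for an estimate `θ` confined to `[lo, up]` with
boundary layers of width `δ`. -/
def projComp (lo up δ θ ω : ℝ) : ℝ :=
  if θ ≤ lo + δ ∧ ω < 0 then (1 - min 1 ((lo + δ - θ) / δ)) * ω
  else if up - δ ≤ θ ∧ 0 < ω then (1 - min 1 ((θ - up + δ) / δ)) * ω
  else ω

/-- The componentwise projection operator. -/
def Proj {m : ℕ} (lo up : Fin m → ℝ) (δ : ℝ) (θ ω : Vec m) : Vec m :=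
  WithLp.toLp 2 fun k => projComp (lo k) (up k) δ (θ k) (ω k)

/-- An inter-proxy potential as a function of the distance, with connectivity radius `rhat`:
it is positive definite, has a positive derivative with respect to the squared distance on
`[0, rhat]`, and is differentiable with respect to the squared distance on `[0, D]`. -/
structure IsPotential (ψ : ℝ → ℝ) (rhat D : ℝ) : Prop where
  nonneg : ∀ d, 0 ≤ d → d ≤ rhat → 0 ≤ ψ d
  eq_zero_iff : ∀ d, 0 ≤ d → d ≤ rhat → (ψ d = 0 ↔ d = 0)
  differentiable : ∀ d, 0 ≤ d → d ≤ D →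
    DifferentiableWithinAt ℝ (fun s => ψ (Real.sqrt s)) (Ici 0) (d ^ 2)
  deriv_pos : ∀ d, 0 ≤ d → d ≤ rhat →
    0 < derivWithin (fun s => ψ (Real.sqrt s)) (Ici 0) (d ^ 2)

/-- `∇ᵢ ψ(‖xᵢ - xⱼ‖)`, the gradient with respect to `xᵢ`. -/
def gradPot {n : ℕ} (ψ : ℝ → ℝ) (xi xj : Vec n) : Vec n := gradient (fun z => ψ ‖z - xj‖) xi

/-- The total potential `½ ∑ᵢ ∑_{j ∈ Nᵢ} ψ(‖xᵢ - xⱼ‖)`. -/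
def totalPot {N n : ℕ} (G : SimpleGraph (Fin N)) [DecidableRel G.Adj] (ψ : ℝ → ℝ)
    (x : Fin N → Vec n) : ℝ :=
  (1 / 2) * ∑ i, ∑ j ∈ G.neighborFinset i, ψ ‖x i - x j‖

/-- The gains and bounds used by the indirect coupling control. -/
structure Design (N n : ℕ) (m : Fin N → ℕ) where
  p : Fin N → ℝ
  k : Fin N → ℝ
  μ : Fin N → ℝ
  β : Fin N → ℝ
  α : ℝ
  δ : ℝ
  ψ : ℝ → ℝ
  θlo : (i : Fin N) → Fin (m i) → ℝ
  θup : (i : Fin N) → Fin (m i) → ℝ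
  η : Fin N → Fin n → ℝ

/-- Positivity of the gains and admissibility of the projection layer. -/
structure Design.Admissible {N n : ℕ} {m : Fin N → ℕ} (K : Design N n m) : Prop where
  p_pos : ∀ i, 0 < K.p i
  k_pos : ∀ i, 0 < K.k i
  μ_pos : ∀ i, 0 < K.μ i
  β_pos : ∀ i, 0 < K.β i
  α_pos : 0 < K.α
  δ_pos : 0 < K.δ
  δ_lt : ∀ i l, K.δ < (K.θup i l - K.θlo i l) / 2

section ControlLaw

variable {N n : ℕ} {m : Fin N → ℕ} (A : (i : Fin N) → ELAgent n (m i)) (K : Design N n m)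

/-- The bounds `f̄ᵢ - ηᵢ` of the saturated agent-proxy terms. -/
def satBound (i : Fin N) (l : Fin n) : ℝ := (A i).fmax l - K.η i l

/-- `φ*`, the least coupling energy over all agents on the sphere of radius `ρ`. -/
def phiStar (ρ : ℝ) : ℝ := ⨅ i, couplingEnergyMin (satBound A K i) (K.p i) ρ

/-- `eᵢ = pᵢ (qᵢ - q̂ᵢ)`; applied to velocities the same formula gives `ėᵢ`. -/
def errVec (i : Fin N) (x y : Vec n) : Vec n := K.p i • (x - y)

/-- `sᵢ = q̇ᵢ + α eᵢ`. -/
def sVec (i : Fin N) (q qh v : Vec n) : Vec n := v + K.α • errVec K i q qh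

/-- The regressor of agent `i` with reference velocity `-α eᵢ` and reference acceleration
`-α ėᵢ`. -/
def regressor (i : Fin N) (q qh v vh : Vec n) : Vec (m i) →L[ℝ] Vec n :=
  (A i).Φ q v (-(K.α • errVec K i q qh)) (-(K.α • errVec K i v vh))

/-- The designed control force `f̂ᵢ`. -/
def designedForce (i : Fin N) (q qh v vh : Vec n) (θh : Vec (m i)) : Vec n :=
  regressor A K i q qh v vh θh
    - Sat (satBound A K i) (K.μ i • sVec K i q qh v + errVec K i q qh)

/-- The raw update direction `ωᵢ = -βᵢ Φᵢᵀ sᵢ`. -/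
def rawUpdate (i : Fin N) (q qh v vh : Vec n) : Vec (m i) :=
  -(K.β i • ContinuousLinearMap.adjoint (regressor A K i q qh v vh) (sVec K i q qh v))

/-- A closed-loop trajectory on `[0, ∞)` started from rest: `q, v` are the positions and velocities
of the agents, `qh, vh` those of the proxies, `θh` the parameter estimates, `T j i` the delay of the
position of proxy `j` used by proxy `i`. Before time `0` the proxies rest at the initial positions
of their agents. -/
structure IsClosedLoop (G : SimpleGraph (Fin N)) [DecidableRel G.Adj]
    (T : Fin N → Fin N → ℝ → ℝ) (q v qh vh : Fin N → ℝ → Vec n)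
    (θh : (i : Fin N) → ℝ → Vec (m i)) : Prop where
  agent_rest : ∀ i, v i 0 = 0
  proxy_history : ∀ i, ∀ t ≤ 0, qh i t = q i 0
  proxy_rest : ∀ i, vh i 0 = 0
  estimate_init : ∀ i l, θh i 0 l ∈ Icc (K.θlo i l) (K.θup i l)
  agent_vel : ∀ i, ∀ t ≥ 0, HasDerivWithinAt (q i) (v i t) (Ici 0) t
  /-- The agent dynamics; the actuators saturate at `fmax`. -/
  agent_dyn : ∀ i, ∀ t ≥ 0, ∃ a, HasDerivWithinAt (v i) a (Ici 0) t ∧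
    (A i).M (q i t) a + (A i).C (q i t) (v i t) (v i t) + (A i).g (q i t)
      = Sat (A i).fmax (designedForce A K i (q i t) (qh i t) (v i t) (vh i t) (θh i t))
  estimate_dyn : ∀ i, ∀ t ≥ 0, HasDerivWithinAt (θh i)
    (Proj (K.θlo i) (K.θup i) K.δ (θh i t)
      (rawUpdate A K i (q i t) (qh i t) (v i t) (vh i t))) (Ici 0) t
  proxy_vel : ∀ i, ∀ t ≥ 0, HasDerivWithinAt (qh i) (vh i t) (Ici 0) t
  proxy_dyn : ∀ i, ∀ t ≥ 0, HasDerivWithinAt (vh i)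
    (Sat (satBound A K i) (errVec K i (q i t) (qh i t))
      - ∑ j ∈ G.neighborFinset i, gradPot K.ψ (qh i t) (qh j (t - T j i t))
      - K.k i • vh i t) (Ici 0) t

end ControlLaw

end

/-!
The closed loop has a Lyapunov function, `totalEnergy`. For every agent it contains `½ sᵀ M s`, the
weighted parameter error, the saturated agent-proxy coupling energy and the kinetic energy of the
proxy (`agentEnergy`); for the network it contains the inter-proxy potential and, for every link, a
Lyapunov-Krasovskii functional (`proxyEnergy`). Skew-symmetry of `Ṁ - 2 C`, linearity in the
parameters, the sign of the projection and monotonicity of the saturation give the dissipation of an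
agent as long as its actuators do not saturate (`exists_hasDerivWithinAt_agentEnergy`). The delayed
inter-proxy force differs from the undelayed one by at most a multiple of the displacement of the
neighbouring proxy over the delay, whose square is bounded by the delay times the integral of the
squared speed (`norm_sub_delay_sq_le`). The Krasovskii terms turn that integral into an
instantaneous one, which the proxy damping dominates (`exists_hasDerivWithinAt_proxyEnergy`). The
delayed positions enter only pointwise, so the delays need not be measurable.

Dissipation holds while the trajectory is confined: agents near their proxies, links short, `s` and
the proxy speeds bounded. Conversely, an energy below `ψ(rhat) ≤ φ*` makes every one of these bounds
strict (`Confined.strictlyConfined`): a displacement on the sphere of radius `ε / 3` would cost `φ*`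
and a link of length `rhat` would cost `ψ(rhat)`. As the initial energy is below `ψ(rhat)`, a
first-exit argument (`forall_nonneg_of_first_exit`) shows that confinement is never lost.

With the energy nonincreasing and nonnegative, a Barbalat-type lemma
(`tendsto_zero_of_dissipation`) sends the agent-proxy displacements and the proxy velocities to
zero. The proxy acceleration is then the Lipschitz undelayed coupling force plus a vanishing
remainder, so this force vanishes too (`tendsto_zero_of_hasDerivWithinAt_add`). Pairing the forces
with relative positions, which are bounded because the graph is connected, shows that the
nonnegative power `⟪u, ∇ψ(‖u‖)⟫` of every link vanishes, and positivity of the derivative of the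
potential forces `u → 0` (`tendsto_sub_of_tendsto_force`).
-/

noncomputable section

/-! ### Scalar differential inequalities and convergence -/

/-- A function with nonpositive right-hand side on an interval is antitone there. -/
lemma antitoneOn_of_exists_hasDerivWithinAt_nonpos {W : ℝ → ℝ} {a b : ℝ} (ha : 0 ≤ a)
    (hc : ContinuousOn W (Icc a b))
    (hW : ∀ t ∈ Ioo a b, ∃ d ≤ 0, HasDerivWithinAt W d (Ici 0) t) :
    AntitoneOn W (Icc a b) := by
  have hW' : ∀ t ∈ Ioo a b, ∃ d ≤ 0, HasDerivAt W d t := fun t ht => by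
    obtain ⟨d, hd, h⟩ := hW t ht
    exact ⟨d, hd, h.hasDerivAt (Ici_mem_nhds (ha.trans_lt ht.1))⟩
  refine antitoneOn_of_deriv_nonpos (convex_Icc a b) hc ?_ ?_
  · intro t ht
    rw [interior_Icc] at ht
    obtain ⟨d, -, h⟩ := hW' t ht
    exact h.differentiableAt.differentiableWithinAt
  · intro t ht
    rw [interior_Icc] at ht
    obtain ⟨d, hd, h⟩ := hW' t ht
    rwa [h.deriv]

/-- A barrier: a function that cannot grow above the level `c` never crosses that level. -/
lemma le_of_hasDerivWithinAt_nonpos_above {f f' : ℝ → ℝ} {c : ℝ}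
    (hf : ∀ t ≥ 0, HasDerivWithinAt f (f' t) (Ici 0) t) (h0 : f 0 ≤ c)
    (hc : ∀ t ≥ 0, c < f t → f' t ≤ 0) : ∀ t ≥ 0, f t ≤ c := by
  intro t ht
  by_contra! hlt
  have hcont : ContinuousOn f (Icc 0 t) := fun s hs =>
    ((hf s hs.1).continuousWithinAt).mono Icc_subset_Ici_self
  -- the last time before `t` at which `f` is at most `c`
  set S := Icc 0 t ∩ f ⁻¹' Iic c with hS
  have hScl : IsClosed S := hcont.preimage_isClosed_of_isClosed isClosed_Icc isClosed_Iic
  have hSne : S.Nonempty := ⟨0, ⟨le_rfl, ht⟩, h0⟩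
  have hSb : BddAbove S := ⟨t, fun s hs => hs.1.2⟩
  have hτ : sSup S ∈ S := hScl.csSup_mem hSne hSb
  set τ := sSup S
  have hanti : AntitoneOn f (Icc τ t) := by
    refine antitoneOn_of_exists_hasDerivWithinAt_nonpos hτ.1.1
      (hcont.mono (Icc_subset_Icc_left hτ.1.1)) fun s hs => ?_
    have hs0 : 0 ≤ s := hτ.1.1.trans hs.1.le
    refine ⟨f' s, hc s hs0 ?_, hf s hs0⟩
    by_contra! hle
    exact (le_csSup hSb ⟨⟨hs0, hs.2.le⟩, hle⟩).not_gt hs.1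
  have := hanti (left_mem_Icc.2 hτ.1.2) (right_mem_Icc.2 hτ.1.2) hτ.1.2
  exact absurd (this.trans hτ.2) (not_le.2 hlt)

/-- A form of Barbalat's lemma: if `W ≥ 0` dissipates at a rate `f ≥ 0` which is bounded away from
zero wherever the Lipschitz signal `g` is, then `g` tends to zero. -/
lemma tendsto_zero_of_dissipation {E : Type*} [NormedAddCommGroup E] {W f : ℝ → ℝ} {g : ℝ → E}
    {L : ℝ} (hW0 : ∀ t ≥ 0, 0 ≤ W t) (hf : ∀ t ≥ 0, 0 ≤ f t)
    (hW : ∀ t ≥ 0, ∃ d ≤ -f t, HasDerivWithinAt W d (Ici 0) t)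
    (hL : 0 ≤ L) (hg : ∀ s ≥ 0, ∀ t ≥ s, ‖g t - g s‖ ≤ L * (t - s))
    (hfg : ∀ η > 0, ∃ c > 0, ∀ t ≥ 0, η ≤ ‖g t‖ → c ≤ f t) :
    Tendsto g atTop (𝓝 0) := by
  have hcont : ContinuousOn W (Ici 0) := fun t ht => by
    obtain ⟨d, -, h⟩ := hW t ht
    exact h.continuousWithinAt
  have hanti : ∀ s ≥ 0, ∀ t ≥ s, W t ≤ W s := fun s hs t hst =>
    antitoneOn_of_exists_hasDerivWithinAt_nonpos hs
      (hcont.mono fun x hx => hs.trans hx.1)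
      (fun x hx => by
        obtain ⟨d, hd, h⟩ := hW x (hs.trans hx.1.le)
        exact ⟨d, hd.trans (neg_nonpos.2 (hf x (hs.trans hx.1.le))), h⟩)
      (left_mem_Icc.2 hst) (right_mem_Icc.2 hst) hst
  obtain ⟨ℓ, hℓ⟩ : ∃ ℓ, Tendsto W atTop (𝓝 ℓ) := by
    have ha : Antitone fun t => W (max t 0) := fun s t hst =>
      hanti _ (le_max_right _ _) _ (max_le_max_right 0 hst)
    have hb : BddBelow (range fun t => W (max t 0)) :=
      ⟨0, by rintro _ ⟨t, rfl⟩; exact hW0 _ (le_max_right _ _)⟩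
    refine ⟨_, (tendsto_atTop_ciInf ha hb).congr' ?_⟩
    filter_upwards [eventually_ge_atTop 0] with t ht
    rw [max_eq_left ht]
  rw [Metric.tendsto_atTop']
  intro η hη
  obtain ⟨c, hc, hcf⟩ := hfg (η / 2) (half_pos hη)
  -- `‖g‖` cannot fall from `η` below `η / 2` within time `h`
  set h := η / (2 * (L + 1)) with hh
  have hpos : 0 < h := by positivity
  have hLh : L * h ≤ η / 2 := by
    rw [hh, mul_div_assoc', div_le_div_iff₀ (by positivity) two_pos]
    nlinarith
  have hdrop : Tendsto (fun t => W t - W (t + h)) atTop (𝓝 0) := by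
    simpa using hℓ.sub (hℓ.comp (tendsto_atTop_add_const_right _ h tendsto_id))
  have hev := (hdrop.eventually (gt_mem_nhds (mul_pos hc hpos))).and (eventually_ge_atTop 0)
  obtain ⟨t₀, ht₀⟩ := eventually_atTop.1 hev
  refine ⟨t₀, fun t ht => ?_⟩
  obtain ⟨hlt, ht0⟩ := ht₀ t ht.le
  rw [dist_zero_right]
  by_contra! hge
  have hlow : ∀ s ∈ Icc t (t + h), c ≤ f s := fun s hs => by
    refine hcf s (ht0.trans hs.1) ?_
    have h1 := hg t ht0 s hs.1
    have h2 : L * (s - t) ≤ L * h := mul_le_mul_of_nonneg_left (by linarith [hs.2]) hL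
    have h3 := norm_sub_norm_le (g t) (g s)
    rw [norm_sub_rev] at h3
    linarith
  have hd : AntitoneOn (fun s => W s + c * s) (Icc t (t + h)) := by
    refine antitoneOn_of_exists_hasDerivWithinAt_nonpos ht0 ?_ fun s hs => ?_
    · exact (hcont.mono fun x hx => ht0.trans hx.1).add (by fun_prop)
    · obtain ⟨d, hd, hder⟩ := hW s (ht0.trans hs.1.le)
      have := hlow s (Ioo_subset_Icc_self hs)
      refine ⟨d + c * 1, by linarith, hder.add ((hasDerivWithinAt_id _ _).const_mul c)⟩
  have := hd (left_mem_Icc.2 (by linarith)) (right_mem_Icc.2 (by linarith))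
    (by linarith : t ≤ t + h)
  simp only at this
  nlinarith

/-- If `w → 0` and `w' = A + B` with `A` Lipschitz and `B → 0`, then `A → 0`. No regularity of `B`
is needed, so `B` may contain discontinuous delays. -/
lemma tendsto_zero_of_hasDerivWithinAt_add {E : Type*} [NormedAddCommGroup E] [NormedSpace ℝ E]
    {w A B : ℝ → E} {L : ℝ} (hw : ∀ t ≥ 0, HasDerivWithinAt w (A t + B t) (Ici 0) t)
    (hw0 : Tendsto w atTop (𝓝 0)) (hB : Tendsto B atTop (𝓝 0))
    (hL : 0 ≤ L) (hA : ∀ s ≥ 0, ∀ t ≥ s, ‖A t - A s‖ ≤ L * (t - s)) :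
    Tendsto A atTop (𝓝 0) := by
  rw [Metric.tendsto_atTop']
  intro η hη
  set h := η / (4 * (L + 1)) with hh
  have hpos : 0 < h := by positivity
  have hLh : L * h ≤ η / 4 := by
    rw [hh, mul_div_assoc', div_le_div_iff₀ (by positivity) (by norm_num)]
    nlinarith
  have e1 := (tendsto_zero_iff_norm_tendsto_zero.1 hw0).eventually
    (gt_mem_nhds (show 0 < h * η / 8 by positivity))
  have e2 := (tendsto_zero_iff_norm_tendsto_zero.1 hB).eventually
    (gt_mem_nhds (show 0 < η / 4 by positivity))
  obtain ⟨t₀, ht₀⟩ := eventually_atTop.1 ((e1.and e2).and (eventually_ge_atTop 0))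
  refine ⟨t₀, fun t ht => ?_⟩
  have ht0 : 0 ≤ t := (ht₀ t ht.le).2
  have key : ‖(w (t + h) - (t + h) • A t) - (w t - t • A t)‖ ≤ η / 2 * (t + h - t) := by
    refine norm_image_sub_le_of_norm_deriv_le_segment' (f := fun s => w s - s • A t)
      (f' := fun s => A s + B s - (1 : ℝ) • A t) ?_ ?_ (t + h) ⟨by linarith, le_rfl⟩
    · intro s hs
      exact ((hw s (ht0.trans hs.1)).mono fun x hx => ht0.trans hx.1).sub
        ((hasDerivWithinAt_id s _).smul_const (A t))
    · intro s hs
      have h1 := hA t ht0 s hs.1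
      have h2 : L * (s - t) ≤ L * h := mul_le_mul_of_nonneg_left (by linarith [hs.2]) hL
      have h3 := (ht₀ s (ht.le.trans hs.1)).1.2
      calc ‖A s + B s - (1 : ℝ) • A t‖ = ‖(A s - A t) + B s‖ := by rw [one_smul]; congr 1; abel
        _ ≤ ‖A s - A t‖ + ‖B s‖ := norm_add_le _ _
        _ ≤ η / 2 := by linarith
  have h1 := (ht₀ t ht.le).1.1
  have h2 := (ht₀ (t + h) (by linarith)).1.1
  have h3 : h * ‖A t‖ ≤ η / 2 * (t + h - t) + ‖w (t + h)‖ + ‖w t‖ := by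
    calc h * ‖A t‖ = ‖h • A t‖ := by rw [norm_smul, Real.norm_of_nonneg hpos.le]
      _ = ‖-((w (t + h) - (t + h) • A t) - (w t - t • A t)) + (w (t + h) - w t)‖ := by
          congr 1; rw [add_smul]; abel
      _ ≤ ‖-((w (t + h) - (t + h) • A t) - (w t - t • A t))‖ + ‖w (t + h) - w t‖ :=
          norm_add_le _ _
      _ ≤ _ := by rw [norm_neg]; linarith [norm_sub_le (w (t + h)) (w t)]
  rw [dist_zero_right]
  have : h * ‖A t‖ < h * η := by nlinarith
  exact lt_of_mul_lt_mul_left this hpos.le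

/-- First-exit argument: an open condition that at every time follows from its validity at all
earlier times holds forever. -/
lemma forall_nonneg_of_first_exit {P : ℝ → Prop}
    (hopen : ∀ t ≥ 0, P t → ∀ᶠ s in 𝓝[≥] t, P s)
    (hstep : ∀ t ≥ 0, (∀ s ≥ 0, s < t → P s) → P t) : ∀ t ≥ 0, P t := by
  intro t ht
  by_contra hPt
  set S := {s | 0 ≤ s ∧ ¬ P s}
  have hSb : BddBelow S := ⟨0, fun s hs => hs.1⟩
  have hSne : S.Nonempty := ⟨t, ht, hPt⟩
  have hτ0 : 0 ≤ sInf S := le_csInf hSne fun s hs => hs.1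
  have hbefore : ∀ s ≥ 0, s < sInf S → P s := fun s hs hlt => by
    by_contra h
    exact (csInf_le hSb ⟨hs, h⟩).not_gt hlt
  have hτ := hstep _ hτ0 hbefore
  obtain ⟨u, hu, hsub⟩ := (mem_nhdsGE_iff_exists_Ico_subset).1 (hopen _ hτ0 hτ)
  have : u ≤ sInf S := le_csInf hSne fun s hs => by
    by_contra! hlt
    exact hs.2 (hsub ⟨csInf_le hSb hs, hlt⟩)
  exact this.not_gt hu

/-- A bound valid strictly before a positive time persists at that time. -/
lemma le_of_forall_lt_le {f : ℝ → ℝ} {c τ : ℝ} (hf : ContinuousOn f (Ici 0)) (hτ : 0 < τ)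
    (h : ∀ s ≥ 0, s < τ → f s ≤ c) : f τ ≤ c := by
  have hlim : Tendsto f (𝓝[Ico 0 τ] τ) (𝓝 (f τ)) :=
    (hf τ hτ.le).mono_left (nhdsWithin_mono _ Ico_subset_Ici_self)
  have : (𝓝[Ico 0 τ] τ).NeBot := by
    rw [← mem_closure_iff_nhdsWithin_neBot, closure_Ico hτ.ne]
    exact right_mem_Icc.2 hτ.le
  exact le_of_tendsto hlim (eventually_mem_nhdsWithin.mono fun s hs => h s hs.1 hs.2)

/-! ### Saturation and coupling energy -/

lemma continuous_sat (b : ℝ) : Continuous (sat b) := by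
  unfold sat; fun_prop

lemma monotone_sat (b : ℝ) : Monotone (sat b) := fun _ _ h =>
  max_le_max_left _ (min_le_min_left _ h)

lemma abs_sat_le {b : ℝ} (hb : 0 ≤ b) (x : ℝ) : |sat b x| ≤ b :=
  abs_le.2 ⟨le_max_left _ _, max_le (by linarith) (min_le_left _ _)⟩

lemma sat_of_abs_le {b x : ℝ} (h : |x| ≤ b) : sat b x = x := by
  rw [sat, min_eq_right (abs_le.1 h).2, max_eq_right (abs_le.1 h).1]

lemma abs_sat_le_abs {b : ℝ} (hb : 0 ≤ b) (x : ℝ) : |sat b x| ≤ |x| := by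
  rcases le_total |x| b with h | h
  · rw [sat_of_abs_le h]
  · exact (abs_sat_le hb x).trans h

/-- The saturation is bounded away from zero wherever its argument is. -/
lemma le_mul_sat {b η x : ℝ} (hη : 0 ≤ η) (hb : 0 ≤ b) (h : η ≤ |x|) :
    η * min η b ≤ x * sat b x := by
  rcases le_total 0 x with hx | hx
  · rw [abs_of_nonneg hx] at h
    have : min η b ≤ sat b x := by
      rw [sat]; exact le_max_of_le_right (le_min (min_le_right _ _) ((min_le_left _ _).trans h))
    exact mul_le_mul h this (le_min hη hb) hx
  · rw [abs_of_nonpos hx] at h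
    have : min η b ≤ -sat b x := by
      rw [sat, le_neg]
      refine max_le (neg_le_neg (min_le_right _ _)) ((min_le_right _ _).trans ?_)
      linarith [min_le_left η b]
    nlinarith [mul_le_mul h this (le_min hη hb) (by linarith)]

lemma mul_sat_nonneg {b : ℝ} (hb : 0 ≤ b) (x : ℝ) : 0 ≤ x * sat b x := by
  simpa using le_mul_sat le_rfl hb (abs_nonneg x)

lemma inner_eq_sum {n : ℕ} (x y : Vec n) : inner ℝ x y = ∑ l, x l * y l := by
  rw [PiLp.inner_apply]
  exact Finset.sum_congr rfl fun l _ => by simp [mul_comm]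

lemma abs_apply_le_norm {n : ℕ} (x : Vec n) (l : Fin n) : |x l| ≤ ‖x‖ := by
  simpa using PiLp.norm_apply_le x l

lemma norm_le_of_forall_abs_le {n : ℕ} {x : Vec n} {c : ℝ} (hc : 0 ≤ c) (h : ∀ l, |x l| ≤ c) :
    ‖x‖ ≤ n * c := by
  refine abs_le_of_sq_le_sq' ?_ (by positivity) |>.2
  rw [EuclideanSpace.norm_sq_eq]
  calc ∑ l, ‖x l‖ ^ 2 ≤ ∑ _l : Fin n, c ^ 2 :=
        Finset.sum_le_sum fun l _ => pow_le_pow_left₀ (norm_nonneg _) (h l) 2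
    _ = n * c ^ 2 := by simp
    _ ≤ (n * c) ^ 2 := by
        rw [mul_pow]
        refine mul_le_mul_of_nonneg_right ?_ (sq_nonneg c)
        exact_mod_cast Nat.le_self_pow two_ne_zero n

lemma HasDerivWithinAt.vec_apply {n : ℕ} {x : ℝ → Vec n} {x' : Vec n} {s : Set ℝ} {t : ℝ}
    (h : HasDerivWithinAt x x' s t) (l : Fin n) :
    HasDerivWithinAt (fun t => x t l) (x' l) s t :=
  (EuclideanSpace.proj l : Vec n →L[ℝ] ℝ).hasFDerivAt.comp_hasDerivWithinAt t h

lemma inner_Sat_nonneg {n : ℕ} {b : Fin n → ℝ} (hb : ∀ l, 0 ≤ b l) (x : Vec n) :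
    0 ≤ inner ℝ x (Sat b x) := by
  rw [inner_eq_sum]
  exact Finset.sum_nonneg fun l _ => mul_sat_nonneg (hb l) _

lemma mul_sat_le_inner_Sat {n : ℕ} {b : Fin n → ℝ} (hb : ∀ l, 0 ≤ b l) (x : Vec n) (l : Fin n) :
    x l * sat (b l) (x l) ≤ inner ℝ x (Sat b x) := by
  rw [inner_eq_sum]
  exact Finset.single_le_sum (f := fun l => x l * sat (b l) (x l))
    (fun l _ => mul_sat_nonneg (hb l) _) (Finset.mem_univ l)

lemma norm_Sat_le {n : ℕ} {b : Fin n → ℝ} (hb : ∀ l, 0 ≤ b l) (x : Vec n) :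
    ‖Sat b x‖ ≤ ‖x‖ := by
  rw [EuclideanSpace.norm_eq, EuclideanSpace.norm_eq]
  exact Real.sqrt_le_sqrt (Finset.sum_le_sum fun l _ =>
    pow_le_pow_left₀ (norm_nonneg _) (abs_sat_le_abs (hb l) _) 2)

/-- Monotonicity of the componentwise saturation, in the direction of the increment. -/
lemma inner_Sat_add_sub_nonneg {n : ℕ} (b : Fin n → ℝ) {c : ℝ} (hc : 0 ≤ c) (s e : Vec n) :
    0 ≤ inner ℝ s (Sat b (c • s + e) - Sat b e) := by
  rw [inner_eq_sum]
  refine Finset.sum_nonneg fun l _ => ?_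
  change 0 ≤ s l * (sat (b l) (c * s l + e l) - sat (b l) (e l))
  rcases le_total 0 (s l) with h | h
  · exact mul_nonneg h (sub_nonneg.2 (monotone_sat _ (by nlinarith)))
  · exact mul_nonneg_of_nonpos_of_nonpos h (sub_nonpos.2 (monotone_sat _ (by nlinarith)))

lemma couplingEnergy_nonneg {n : ℕ} {b : Fin n → ℝ} {p : ℝ} (hb : ∀ l, 0 ≤ b l) (hp : 0 ≤ p)
    (x : Vec n) : 0 ≤ couplingEnergy b p x := by
  refine Finset.sum_nonneg fun l _ => ?_
  have h0 : sat (b l) 0 = 0 := sat_of_abs_le (by simpa using hb l)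
  rcases le_total 0 (x l) with h | h
  · refine intervalIntegral.integral_nonneg h fun σ hσ => ?_
    rw [← h0]
    exact monotone_sat _ (mul_nonneg hp hσ.1)
  · rw [intervalIntegral.integral_symm, ← intervalIntegral.integral_neg]
    refine intervalIntegral.integral_nonneg h fun σ hσ => ?_
    rw [neg_nonneg, ← h0]
    exact monotone_sat _ (mul_nonpos_of_nonneg_of_nonpos hp hσ.2)

lemma couplingEnergy_zero {n : ℕ} (b : Fin n → ℝ) (p : ℝ) : couplingEnergy b p 0 = 0 := by
  simp [couplingEnergy]

lemma hasDerivWithinAt_couplingEnergy {n : ℕ} (b : Fin n → ℝ) (p : ℝ) {x : ℝ → Vec n} {x' : Vec n}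
    {S : Set ℝ} {t : ℝ} (h : HasDerivWithinAt x x' S t) :
    HasDerivWithinAt (fun t => couplingEnergy b p (x t)) (inner ℝ (Sat b (p • x t)) x') S t := by
  rw [inner_eq_sum]
  refine HasDerivWithinAt.fun_sum fun l _ => ?_
  have hc : Continuous fun σ => sat (b l) (p * σ) := (continuous_sat _).comp (by fun_prop)
  exact (hc.integral_hasStrictDerivAt 0 (x t l)).hasDerivAt.comp_hasDerivWithinAt t (h.vec_apply l)

/-! ### Parameter projection -/

/-- The projection does not increase the parameter estimation energy. -/
lemma sub_mul_projComp_le {lo up δ θ θ₀ ω : ℝ} (hδ : 0 < δ) (hθ₀ : θ₀ ∈ Icc (lo + δ) (up - δ)) :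
    (θ - θ₀) * projComp lo up δ θ ω ≤ (θ - θ₀) * ω := by
  unfold projComp
  split_ifs with h1 h2
  · have hm : 0 ≤ min 1 ((lo + δ - θ) / δ) :=
      le_min zero_le_one (div_nonneg (by linarith [h1.1]) hδ.le)
    have := mul_nonneg (mul_nonneg hm (neg_nonneg.2 h1.2.le))
      (by linarith [h1.1, hθ₀.1] : 0 ≤ θ₀ - θ)
    nlinarith
  · have hm : 0 ≤ min 1 ((θ - up + δ) / δ) :=
      le_min zero_le_one (div_nonneg (by linarith [h2.1]) hδ.le)
    have := mul_nonneg (mul_nonneg hm h2.2.le) (by linarith [h2.1, hθ₀.2] : 0 ≤ θ - θ₀)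
    nlinarith
  · exact le_rfl

lemma inner_Proj_le {m : ℕ} {lo up : Fin m → ℝ} {δ : ℝ} {θ θ₀ ω : Vec m} (hδ : 0 < δ)
    (hθ₀ : ∀ l, θ₀ l ∈ Icc (lo l + δ) (up l - δ)) :
    inner ℝ (θ - θ₀) (Proj lo up δ θ ω) ≤ inner ℝ (θ - θ₀) ω := by
  rw [inner_eq_sum, inner_eq_sum]
  exact Finset.sum_le_sum fun l _ => sub_mul_projComp_le hδ (hθ₀ l)

lemma projComp_nonneg_of_le {lo up δ θ ω : ℝ} (hδ : 0 < δ) (h : θ ≤ lo) :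
    0 ≤ projComp lo up δ θ ω := by
  unfold projComp
  split_ifs with h1 h2
  · rw [min_eq_left ((one_le_div hδ).2 (by linarith))]; simp
  · exact mul_nonneg (sub_nonneg.2 (min_le_left _ _)) h2.2.le
  · by_contra! hω
    exact h1 ⟨by linarith, hω⟩

lemma projComp_nonpos_of_ge {lo up δ θ ω : ℝ} (hδ : 0 < δ) (h : up ≤ θ) :
    projComp lo up δ θ ω ≤ 0 := by
  unfold projComp
  split_ifs with h1 h2
  · exact mul_nonpos_of_nonneg_of_nonpos (sub_nonneg.2 (min_le_left _ _)) h1.2.le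
  · rw [min_eq_left ((one_le_div hδ).2 (by linarith))]; simp
  · by_contra! hω
    exact h2 ⟨by linarith, hω⟩

/-- The estimates never leave the projection box. -/
lemma mem_Icc_of_hasDerivWithinAt_Proj {m : ℕ} {lo up : Fin m → ℝ} {δ : ℝ} (hδ : 0 < δ)
    {θ ω : ℝ → Vec m} (hθ : ∀ t ≥ 0, HasDerivWithinAt θ (Proj lo up δ (θ t) (ω t)) (Ici 0) t)
    (h0 : ∀ l, θ 0 l ∈ Icc (lo l) (up l)) : ∀ t ≥ 0, ∀ l, θ t l ∈ Icc (lo l) (up l) := by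
  intro t ht l
  constructor
  · have := le_of_hasDerivWithinAt_nonpos_above (f := fun t => -θ t l) (c := -lo l)
      (fun t ht => ((hθ t ht).vec_apply l).neg) (neg_le_neg (h0 l).1)
      (fun t _ hlt => neg_nonpos.2 (projComp_nonneg_of_le hδ (by linarith))) t ht
    linarith
  · exact le_of_hasDerivWithinAt_nonpos_above (f := fun t => θ t l) (c := up l)
      (fun t ht => (hθ t ht).vec_apply l) (h0 l).2
      (fun t _ hlt => projComp_nonpos_of_ge hδ hlt.le) t ht

/-! ### Inter-proxy potential -/

/-- The gradient of `u ↦ ψ ‖u‖` in closed form, `2 (∂ψ/∂(d²)) u` at `d = ‖u‖`. -/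
def potForce {n : ℕ} (ψ : ℝ → ℝ) (u : Vec n) : Vec n :=
  (2 * derivWithin (fun s => ψ (Real.sqrt s)) (Ici 0) (‖u‖ ^ 2)) • u

lemma potForce_zero {n : ℕ} (ψ : ℝ → ℝ) : potForce ψ (0 : Vec n) = 0 := smul_zero _

lemma potForce_neg {n : ℕ} (ψ : ℝ → ℝ) (u : Vec n) : potForce ψ (-u) = -potForce ψ u := by
  simp [potForce]

namespace IsPotential

variable {ψ : ℝ → ℝ} {rhat D : ℝ} {n : ℕ}

lemma hasFDerivAt (hψ : IsPotential ψ rhat D) {u : Vec n} (hu : ‖u‖ ≤ D) :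
    HasFDerivAt (fun z : Vec n => ψ ‖z‖) (innerSL ℝ (potForce ψ u)) u := by
  have h1 := (hψ.differentiable ‖u‖ (norm_nonneg u) hu).hasDerivWithinAt
  have h2 : HasFDerivAt (fun z : Vec n => ‖z‖ ^ 2) _ u := (hasFDerivAt_id u).norm_sq
  have h3 := h1.comp_hasFDerivAt u h2 (Eventually.of_forall fun z => sq_nonneg ‖z‖)
  refine (h3.congr_fderiv ?_).congr_of_eventuallyEq (Eventually.of_forall fun z => ?_)
  · ext z
    simp [potForce]
    ring
  · simp [Real.sqrt_sq (norm_nonneg z)]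

lemma gradPot_eq (hψ : IsPotential ψ rhat D) {x y : Vec n} (h : ‖x - y‖ ≤ D) :
    gradPot ψ x y = potForce ψ (x - y) := by
  have h1 := HasFDerivAt.comp (g := fun z : Vec n => ψ ‖z‖) (f := fun z => z - y) x
    (hψ.hasFDerivAt h) ((hasFDerivAt_id x).sub_const y)
  rw [ContinuousLinearMap.comp_id] at h1
  exact HasGradientAt.gradient (hasGradientAt_iff_hasFDerivAt.2 h1)

lemma hasDerivWithinAt (hψ : IsPotential ψ rhat D) {x y : ℝ → Vec n} {x' y' : Vec n} {S : Set ℝ}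
    {t : ℝ} (h : ‖x t - y t‖ ≤ D) (hx : HasDerivWithinAt x x' S t)
    (hy : HasDerivWithinAt y y' S t) :
    HasDerivWithinAt (fun t => ψ ‖x t - y t‖) (inner ℝ (potForce ψ (x t - y t)) (x' - y')) S t := by
  have h1 := HasFDerivAt.comp_hasDerivWithinAt (l := fun z : Vec n => ψ ‖z‖)
    (f := fun t => x t - y t) t (hψ.hasFDerivAt h) (hx.sub hy)
  rw [innerSL_apply_apply] at h1
  exact h1

lemma inner_potForce_nonneg (hψ : IsPotential ψ rhat D) {u : Vec n} (hu : ‖u‖ ≤ rhat) :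
    0 ≤ inner ℝ u (potForce ψ u) := by
  have := hψ.deriv_pos ‖u‖ (norm_nonneg u) hu
  rw [potForce, inner_smul_right, real_inner_self_eq_norm_sq]
  positivity

lemma inner_potForce_pos (hψ : IsPotential ψ rhat D) {u : Vec n} (hu : ‖u‖ ≤ rhat) (h0 : u ≠ 0) :
    0 < inner ℝ u (potForce ψ u) := by
  have := hψ.deriv_pos ‖u‖ (norm_nonneg u) hu
  have := norm_pos_iff.2 h0
  rw [potForce, inner_smul_right, real_inner_self_eq_norm_sq]
  positivity

/-- On a compact shell the coupling power `⟪u, ∇ψ⟫` is bounded away from zero. -/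
lemma exists_pos_le_inner_potForce (hψ : IsPotential ψ rhat D)
    (hc : ContinuousOn (potForce ψ : Vec n → Vec n) (Metric.closedBall 0 rhat)) {η : ℝ}
    (hη : 0 < η) : ∃ c > 0, ∀ u : Vec n, η ≤ ‖u‖ → ‖u‖ ≤ rhat → c ≤ inner ℝ u (potForce ψ u) := by
  set S := Metric.closedBall (0 : Vec n) rhat ∩ {u | η ≤ ‖u‖}
  have hS : IsCompact S :=
    (isCompact_closedBall _ _).inter_right (isClosed_le continuous_const continuous_norm)
  rcases S.eq_empty_or_nonempty with h | h
  · exact ⟨1, one_pos, fun u h1 h2 =>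
      absurd (show u ∈ S from ⟨mem_closedBall_zero_iff.2 h2, h1⟩) (by simp [h])⟩
  · obtain ⟨u₀, hu₀, hmin⟩ := hS.exists_isMinOn h
      (f := fun u => inner ℝ u (potForce ψ u))
      (continuousOn_id.inner (hc.mono inter_subset_left))
    refine ⟨_, hψ.inner_potForce_pos (mem_closedBall_zero_iff.1 hu₀.1) ?_, fun u h1 h2 =>
      hmin ⟨mem_closedBall_zero_iff.2 h2, h1⟩⟩
    exact norm_pos_iff.1 (hη.trans_le hu₀.2)

end IsPotential

/-! ### Delayed signals -/

/-- The energy `∫₀ᵗ ‖w‖²` dissipated by a velocity signal. -/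
def velEnergy {n : ℕ} (w : ℝ → Vec n) (t : ℝ) : ℝ := ∫ s in (0 : ℝ)..t, ‖w s‖ ^ 2

/-- The Lyapunov-Krasovskii functional `∫_{-τ}⁰ ∫_{t+σ}ᵗ ‖w‖² ds dσ` of a delay bounded by `τ`,
with the outer integral over `σ` carried out on the primitive `velEnergy w`. -/
def delayEnergy {n : ℕ} (w : ℝ → Vec n) (τ t : ℝ) : ℝ :=
  τ * velEnergy w t - ((∫ s in (0 : ℝ)..t, velEnergy w s) - ∫ s in (0 : ℝ)..(t - τ), velEnergy w s)

section Delay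

variable {n : ℕ} {w : ℝ → Vec n}

lemma hasDerivAt_velEnergy (hw : Continuous w) (t : ℝ) :
    HasDerivAt (velEnergy w) (‖w t‖ ^ 2) t :=
  ((hw.norm.pow 2).integral_hasStrictDerivAt 0 t).hasDerivAt

lemma continuous_velEnergy (hw : Continuous w) : Continuous (velEnergy w) :=
  continuous_iff_continuousAt.2 fun t => (hasDerivAt_velEnergy hw t).continuousAt

lemma monotone_velEnergy (hw : Continuous w) : Monotone (velEnergy w) :=
  monotone_of_hasDerivAt_nonneg (hasDerivAt_velEnergy hw) fun _ => sq_nonneg _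

lemma hasDerivAt_delayEnergy (hw : Continuous w) (τ t : ℝ) :
    HasDerivAt (delayEnergy w τ) (τ * ‖w t‖ ^ 2 - (velEnergy w t - velEnergy w (t - τ))) t := by
  have hc := continuous_velEnergy hw
  have h1 := (hc.integral_hasStrictDerivAt 0 t).hasDerivAt
  have h2 := (hc.integral_hasStrictDerivAt 0 (t - τ)).hasDerivAt.comp t
    ((hasDerivAt_id t).sub_const τ)
  rw [mul_one] at h2
  exact ((hasDerivAt_velEnergy hw t).const_mul τ).sub (h1.sub h2)

lemma delayEnergy_nonneg (hw : Continuous w) {τ : ℝ} (hτ : 0 ≤ τ) (t : ℝ) :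
    0 ≤ delayEnergy w τ t := by
  have hc := continuous_velEnergy hw
  rw [delayEnergy, intervalIntegral.integral_interval_sub_left (hc.intervalIntegrable _ _)
    (hc.intervalIntegrable _ _), sub_nonneg]
  calc ∫ s in (t - τ)..t, velEnergy w s ≤ ∫ _s in (t - τ)..t, velEnergy w t :=
        intervalIntegral.integral_mono_on (by linarith) (hc.intervalIntegrable _ _)
          (by simp) fun s hs => monotone_velEnergy hw hs.2
    _ = τ * velEnergy w t := by simp

lemma delayEnergy_zero (hw0 : ∀ t ≤ 0, w t = 0) {τ : ℝ} (hτ : 0 ≤ τ) : delayEnergy w τ 0 = 0 := by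
  have hF : ∀ t ≤ 0, velEnergy w t = 0 := fun t ht => by
    rw [velEnergy, intervalIntegral.integral_symm, neg_eq_zero]
    refine (intervalIntegral.integral_congr (g := fun _ => (0 : ℝ)) fun s hs => ?_).trans (by simp)
    rw [uIcc_of_le ht] at hs
    simp [hw0 s hs.2]
  have hH : ∫ s in (0 : ℝ)..(0 - τ), velEnergy w s = 0 := by
    refine (intervalIntegral.integral_congr (g := fun _ => (0 : ℝ)) fun s hs => ?_).trans (by simp)
    rw [uIcc_of_ge (by linarith)] at hs
    exact hF s hs.2
  simp only [delayEnergy, hH, hF 0 le_rfl]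
  simp

/-- The Cauchy-Schwarz bound of a displacement over a delay by the energy of the velocity. -/
lemma norm_sub_delay_sq_le (hw : Continuous w) {x : ℝ → Vec n} (hx : ∀ t, HasDerivAt x (w t) t)
    {s τ : ℝ} (hs : 0 ≤ s) (hsτ : s ≤ τ) (t : ℝ) :
    ‖x t - x (t - s)‖ ^ 2 ≤ τ * (velEnergy w t - velEnergy w (t - τ)) := by
  have hmono := monotone_velEnergy hw
  have key : ‖x t - x (t - s)‖ ^ 2 ≤ s * (velEnergy w t - velEnergy w (t - s)) := by
    rcases hs.eq_or_lt with rfl | hs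
    · simp
    set u := x t - x (t - s) with hu
    -- integrate `2 s ⟪u, w⟫ ≤ ‖u‖² + s² ‖w‖²` over the delay interval
    have hG : Monotone fun σ => s ^ 2 * velEnergy w σ + ‖u‖ ^ 2 * σ - 2 * s * inner ℝ u (x σ) := by
      refine monotone_of_hasDerivAt_nonneg
        (f' := fun σ => s ^ 2 * ‖w σ‖ ^ 2 + ‖u‖ ^ 2 * 1 - 2 * s * inner ℝ u (w σ))
        (fun σ => ?_) fun σ => ?_
      · have h1 : HasDerivAt (fun σ => inner ℝ u (x σ)) (inner ℝ u (w σ)) σ :=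
          (innerSL ℝ u).hasFDerivAt.comp_hasDerivAt σ (hx σ)
        exact (((hasDerivAt_velEnergy hw σ).const_mul _).add
          ((hasDerivAt_id σ).const_mul _)).sub (h1.const_mul _)
      · have h2 := real_inner_le_norm u (w σ)
        have h3 := mul_le_mul_of_nonneg_left h2 (by positivity : 0 ≤ 2 * s)
        simp only [Pi.zero_apply]
        nlinarith [sq_nonneg (s * ‖w σ‖ - ‖u‖)]
    have h4 := hG (by linarith : t - s ≤ t)
    have h5 : inner ℝ u (x t) - inner ℝ u (x (t - s)) = ‖u‖ ^ 2 := by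
      rw [← inner_sub_right, ← hu, real_inner_self_eq_norm_sq]
    simp only at h4
    refine le_of_mul_le_mul_left ?_ hs
    nlinarith
  refine key.trans (mul_le_mul hsτ ?_ ?_ (hs.trans hsτ))
  · linarith [hmono (by linarith : t - τ ≤ t - s)]
  · linarith [hmono (by linarith : t - s ≤ t)]

end Delay

/-! ### Energy of an agent and its proxy -/

section Agent

variable {N n : ℕ} {m : Fin N → ℕ} (A : (i : Fin N) → ELAgent n (m i)) (K : Design N n m)

/-- The energy of agent `i` and its proxy: the kinetic-like energy `½ sᵀ M s`, the weighted
parameter estimation error, the coupling energy and the kinetic energy of the proxy. -/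
def agentEnergy (i : Fin N) (q qh v vh : Vec n) (θh : Vec (m i)) : ℝ :=
  1 / 2 * inner ℝ ((A i).M q (sVec K i q qh v)) (sVec K i q qh v)
    + ‖(A i).θ - θh‖ ^ 2 / (2 * K.β i)
    + couplingEnergy (satBound A K i) (K.p i) (q - qh) + 1 / 2 * ‖vh‖ ^ 2

variable {A K} {i : Fin N}

/-- Each of the individual energies is bounded by the energy of the agent. -/
lemma energies_le_agentEnergy {lam₁ lam₂ : ℝ} (hEL : (A i).IsEulerLagrange lam₁ lam₂)
    (hK : K.Admissible) (hb : ∀ l, 0 ≤ satBound A K i l) (q qh v vh : Vec n) (θh : Vec (m i)) :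
    0 ≤ agentEnergy A K i q qh v vh θh ∧
    lam₁ / 2 * ‖sVec K i q qh v‖ ^ 2 ≤ agentEnergy A K i q qh v vh θh ∧
    couplingEnergy (satBound A K i) (K.p i) (q - qh) ≤ agentEnergy A K i q qh v vh θh ∧
    1 / 2 * ‖vh‖ ^ 2 ≤ agentEnergy A K i q qh v vh θh := by
  have h1 := hEL.inertia_lower q (sVec K i q qh v)
  have h2 : 0 ≤ lam₁ * ‖sVec K i q qh v‖ ^ 2 := mul_nonneg hEL.lam₁_pos.le (sq_nonneg _)
  have h3 : 0 ≤ ‖(A i).θ - θh‖ ^ 2 / (2 * K.β i) :=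
    div_nonneg (sq_nonneg _) (mul_nonneg two_pos.le (hK.β_pos i).le)
  have h4 := couplingEnergy_nonneg hb (hK.p_pos i).le (q - qh)
  have h5 := sq_nonneg ‖vh‖
  unfold agentEnergy
  refine ⟨?_, ?_, ?_, ?_⟩ <;> linarith

/-- The error equation `M ṡ + C s = Φ (θ̂ - θ) - Sat (μ s + e)` of an unsaturated agent. -/
lemma error_dynamics {lam₁ lam₂ : ℝ} (hEL : (A i).IsEulerLagrange lam₁ lam₂)
    {q qh v vh a : Vec n} {θh : Vec (m i)}
    (hdyn : (A i).M q a + (A i).C q v v + (A i).g q = designedForce A K i q qh v vh θh) :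
    (A i).M q (a + K.α • errVec K i v vh) + (A i).C q v (sVec K i q qh v)
      = regressor A K i q qh v vh (θh - (A i).θ)
        - Sat (satBound A K i) (K.μ i • sVec K i q qh v + errVec K i q qh) := by
  have hlin := hEL.linear_param q v (-(K.α • errVec K i q qh)) (-(K.α • errVec K i v vh))
  change _ = regressor A K i q qh v vh (A i).θ at hlin
  rw [map_sub, ← hlin, sub_right_comm]
  rw [designedForce] at hdyn
  rw [← hdyn, sVec]
  simp only [map_add, map_neg]
  abel

lemma hasDerivWithinAt_errVec {q qh : ℝ → Vec n} {v vh : Vec n} {S : Set ℝ} {t : ℝ}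
    (hq : HasDerivWithinAt q v S t) (hqh : HasDerivWithinAt qh vh S t) :
    HasDerivWithinAt (fun t => errVec K i (q t) (qh t)) (errVec K i v vh) S t :=
  (hq.sub hqh).const_smul (K.p i)

/-- The kinetic-like energy changes at the rate `⟪M ṡ + C s, s⟫`, by skew-symmetry of `Ṁ - 2 C`. -/
lemma hasDerivWithinAt_kineticEnergy {lam₁ lam₂ : ℝ} (hEL : (A i).IsEulerLagrange lam₁ lam₂)
    {q s : ℝ → Vec n} {v s' : Vec n} {S : Set ℝ} {t : ℝ} (hq : HasDerivWithinAt q v S t)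
    (hs : HasDerivWithinAt s s' S t) :
    HasDerivWithinAt (fun t => 1 / 2 * inner ℝ ((A i).M (q t) (s t)) (s t))
      (inner ℝ ((A i).M (q t) s' + (A i).C (q t) v (s t)) (s t)) S t := by
  have hM : HasDerivWithinAt (fun t => (A i).M (q t)) (fderiv ℝ (A i).M (q t) v) S t :=
    (hEL.inertia_diff (q t)).hasFDerivAt.comp_hasDerivWithinAt t hq
  refine (((hM.clm_apply hs).inner ℝ hs).const_mul (1 / 2)).congr_deriv ?_
  have h1 := hEL.skew (q t) v (s t) (s t)
  rw [real_inner_comm] at h1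
  simp only [sub_apply, smul_apply, inner_sub_right, inner_smul_right] at h1
  have h2 := hEL.inertia_symm (q t) (s t) s'
  rw [inner_add_left, inner_add_left, h2, real_inner_comm ((A i).M (q t) s') (s t),
    real_inner_comm (s t) (fderiv ℝ (A i).M (q t) v (s t)),
    real_inner_comm (s t) ((A i).C (q t) v (s t))]
  linarith

/-- Dissipation of the energy of an unsaturated agent whose proxy is pulled by the force `z`. -/
lemma exists_hasDerivWithinAt_agentEnergy {lam₁ lam₂ : ℝ}
    (hEL : (A i).IsEulerLagrange lam₁ lam₂) (hK : K.Admissible)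
    (hθ : ∀ l, (A i).θ l ∈ Icc (K.θlo i l + K.δ) (K.θup i l - K.δ))
    {q v qh vh : ℝ → Vec n} {θh : ℝ → Vec (m i)} {a z : Vec n} {S : Set ℝ} {t : ℝ}
    (hq : HasDerivWithinAt q (v t) S t) (hv : HasDerivWithinAt v a S t)
    (hdyn : (A i).M (q t) a + (A i).C (q t) (v t) (v t) + (A i).g (q t)
      = designedForce A K i (q t) (qh t) (v t) (vh t) (θh t))
    (hθh : HasDerivWithinAt θh (Proj (K.θlo i) (K.θup i) K.δ (θh t)
      (rawUpdate A K i (q t) (qh t) (v t) (vh t))) S t)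
    (hqh : HasDerivWithinAt qh (vh t) S t)
    (hvh : HasDerivWithinAt vh
      (Sat (satBound A K i) (errVec K i (q t) (qh t)) - z - K.k i • vh t) S t) :
    ∃ d ≤ -(K.α * inner ℝ (errVec K i (q t) (qh t))
          (Sat (satBound A K i) (errVec K i (q t) (qh t))))
        - inner ℝ (vh t) z - K.k i * ‖vh t‖ ^ 2,
      HasDerivWithinAt (fun t => agentEnergy A K i (q t) (qh t) (v t) (vh t) (θh t)) d S t := by
  have hs : HasDerivWithinAt (fun t => sVec K i (q t) (qh t) (v t))
      (a + K.α • errVec K i (v t) (vh t)) S t :=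
    hv.add ((hasDerivWithinAt_errVec hq hqh).const_smul K.α)
  have d1 := hasDerivWithinAt_kineticEnergy hEL hq hs
  rw [error_dynamics hEL hdyn] at d1
  have d2 := ((hθh.const_sub (A i).θ).norm_sq).div_const (2 * K.β i)
  have d3 := hasDerivWithinAt_couplingEnergy (satBound A K i) (K.p i) (hq.sub hqh)
  have d4 := hvh.norm_sq.const_mul (1 / 2)
  refine ⟨_, ?_, ((d1.add d2).add d3).add d4⟩
  set e := errVec K i (q t) (qh t) with he
  set s := sVec K i (q t) (qh t) (v t) with hsdef
  set R := regressor A K i (q t) (qh t) (v t) (vh t)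
  set P := Proj (K.θlo i) (K.θup i) K.δ (θh t) (rawUpdate A K i (q t) (qh t) (v t) (vh t))
  have hβ := hK.β_pos i
  have hproj : 2 * inner ℝ ((A i).θ - θh t) (-P) / (2 * K.β i)
      ≤ - inner ℝ (R (θh t - (A i).θ)) s := by
    have h := inner_Proj_le (θ := θh t) (ω := rawUpdate A K i (q t) (qh t) (v t) (vh t))
      hK.δ_pos hθ
    have hω : inner ℝ (θh t - (A i).θ) (rawUpdate A K i (q t) (qh t) (v t) (vh t))
        = -(K.β i * inner ℝ (R (θh t - (A i).θ)) s) := by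
      rw [rawUpdate, inner_neg_right, inner_smul_right, ContinuousLinearMap.adjoint_inner_right]
    rw [hω] at h
    rw [← neg_sub (θh t), inner_neg_neg, mul_div_mul_left _ _ two_ne_zero, div_le_iff₀ hβ]
    linarith
  have hsat := inner_Sat_add_sub_nonneg (satBound A K i) (hK.μ_pos i).le s e
  have hv' : v t = s - K.α • e := by rw [hsdef, he, sVec, add_sub_cancel_right]
  have hpe : K.p i • (q - qh) t = e := rfl
  rw [hpe]
  rw [inner_sub_left, inner_sub_right, inner_sub_right, inner_sub_right, hv', inner_sub_right,
    inner_smul_right, inner_smul_right, real_inner_self_eq_norm_sq,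
    real_inner_comm (vh t) (Sat (satBound A K i) e), real_inner_comm e (Sat (satBound A K i) e)]
  rw [inner_sub_right, real_inner_comm (Sat _ (K.μ i • s + e)), real_inner_comm (Sat _ e) s] at hsat
  linarith

end Agent

/-! ### Energy of the proxy network -/

/-- Componentwise Lipschitz bounds on a force perturbation, in the form of a power estimate. -/
lemma inner_le_of_abs_le {n : ℕ} {ζ ϑ a : ℝ} (hζ : 0 ≤ ζ) (hϑ : 0 ≤ ϑ) (ha : 0 < a)
    {f Δ : Vec n} (hf : ∀ l, |f l| ≤ ζ * |Δ l| + ϑ * ‖Δ‖) (x : Vec n) :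
    inner ℝ x f ≤ a * (ζ + ϑ) / 2 * ‖x‖ ^ 2 + (ζ + n * ϑ) / (2 * a) * ‖Δ‖ ^ 2 := by
  have young : ∀ y z : ℝ, y * z ≤ a / 2 * y ^ 2 + 1 / (2 * a) * z ^ 2 := fun y z => by
    have h : a / 2 * y ^ 2 + 1 / (2 * a) * z ^ 2 - y * z = (a * y - z) ^ 2 / (2 * a) := by
      field_simp; ring
    have : 0 ≤ (a * y - z) ^ 2 / (2 * a) := by positivity
    linarith
  have hl : ∀ l, x l * f l ≤ a * (ζ + ϑ) / 2 * x l ^ 2 + 1 / (2 * a) * ζ * Δ l ^ 2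
      + 1 / (2 * a) * ϑ * ‖Δ‖ ^ 2 := fun l => by
    have h1 : x l * f l ≤ |x l| * (ζ * |Δ l| + ϑ * ‖Δ‖) :=
      (le_abs_self _).trans (by rw [abs_mul]; exact mul_le_mul_of_nonneg_left (hf l) (abs_nonneg _))
    have h2 := mul_le_mul_of_nonneg_left (young |x l| |Δ l|) hζ
    have h3 := mul_le_mul_of_nonneg_left (young |x l| ‖Δ‖) hϑ
    rw [sq_abs] at h2 h3
    rw [sq_abs] at h2
    linarith
  rw [inner_eq_sum]
  refine (Finset.sum_le_sum fun l _ => hl l).trans (le_of_eq ?_)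
  rw [Finset.sum_add_distrib, Finset.sum_add_distrib, ← Finset.mul_sum, ← Finset.mul_sum,
    ← EuclideanSpace.real_norm_sq_eq, ← EuclideanSpace.real_norm_sq_eq]
  simp only [Finset.sum_const, Finset.card_univ, Fintype.card_fin, nsmul_eq_mul]
  ring

section Network

variable {N n : ℕ} (G : SimpleGraph (Fin N)) [DecidableRel G.Adj]

lemma sum_neighborFinset_comm (f : Fin N → Fin N → ℝ) :
    ∑ i, ∑ j ∈ G.neighborFinset i, f i j = ∑ i, ∑ j ∈ G.neighborFinset i, f j i :=
  Finset.sum_comm' fun i j => by simp [G.adj_comm]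

/-- Each edge contributes its full potential to the total potential. -/
lemma le_totalPot {ψ : ℝ → ℝ} {x : Fin N → Vec n}
    (h0 : ∀ i j, G.Adj i j → 0 ≤ ψ ‖x i - x j‖) {i j : Fin N} (hij : G.Adj i j) :
    ψ ‖x i - x j‖ ≤ totalPot G ψ x := by
  have hrow : ∀ i j, G.Adj i j → ψ ‖x i - x j‖ ≤ ∑ j ∈ G.neighborFinset i, ψ ‖x i - x j‖ :=
    fun i j h => Finset.single_le_sum (f := fun j => ψ ‖x i - x j‖)
      (fun l hl => h0 i l ((G.mem_neighborFinset i l).1 hl)) ((G.mem_neighborFinset i j).2 h)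
  have hsum := Finset.sum_le_sum_of_subset_of_nonneg (Finset.subset_univ {i, j})
    (f := fun i => ∑ j ∈ G.neighborFinset i, ψ ‖x i - x j‖)
    fun k _ _ => Finset.sum_nonneg fun l hl => h0 k l ((G.mem_neighborFinset k l).1 hl)
  rw [Finset.sum_pair hij.ne] at hsum
  have h1 := hrow i j hij
  have h2 := hrow j i hij.symm
  rw [norm_sub_rev] at h2
  unfold totalPot
  linarith

lemma totalPot_nonneg {ψ : ℝ → ℝ} {x : Fin N → Vec n}
    (h0 : ∀ i j, G.Adj i j → 0 ≤ ψ ‖x i - x j‖) : 0 ≤ totalPot G ψ x :=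
  mul_nonneg (by norm_num) (Finset.sum_nonneg fun i _ => Finset.sum_nonneg fun j hj =>
    h0 i j ((G.mem_neighborFinset i j).1 hj))

/-- The energy stored in the proxy couplings, including the Lyapunov-Krasovskii functionals which
account for the delays. -/
def proxyEnergy (ψ : ℝ → ℝ) (κ : ℝ) (Tbar : Fin N → Fin N → ℝ) (x w : Fin N → ℝ → Vec n)
    (t : ℝ) : ℝ :=
  totalPot G ψ (fun i => x i t)
    + ∑ i, ∑ j ∈ G.neighborFinset i, κ * (Tbar j i * delayEnergy (w j) (Tbar j i) t)

variable {G}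

/-- The total potential changes at the rate of the power of the undelayed forces. -/
lemma hasDerivWithinAt_totalPot {ψ : ℝ → ℝ} {rhat D : ℝ} (hψ : IsPotential ψ rhat D)
    {x : Fin N → ℝ → Vec n} {x' : Fin N → Vec n} {S : Set ℝ} {t : ℝ}
    (hx : ∀ i, HasDerivWithinAt (x i) (x' i) S t)
    (hD : ∀ i j, G.Adj i j → ‖x i t - x j t‖ ≤ D) :
    HasDerivWithinAt (fun t => totalPot G ψ (fun i => x i t))
      (∑ i, ∑ j ∈ G.neighborFinset i, inner ℝ (x' i) (potForce ψ (x i t - x j t))) S t := by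
  have h : HasDerivWithinAt (fun t => totalPot G ψ (fun i => x i t))
      (1 / 2 * ∑ i, ∑ j ∈ G.neighborFinset i,
        inner ℝ (potForce ψ (x i t - x j t)) (x' i - x' j)) S t :=
    HasDerivWithinAt.const_mul _ (HasDerivWithinAt.fun_sum fun i _ =>
      HasDerivWithinAt.fun_sum fun j hj =>
        hψ.hasDerivWithinAt (hD i j ((G.mem_neighborFinset i j).1 hj)) (hx i) (hx j))
  refine h.congr_deriv ?_
  simp only [inner_sub_right, Finset.sum_sub_distrib]
  rw [sum_neighborFinset_comm G fun i j => inner ℝ (potForce ψ (x i t - x j t)) (x' j)]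
  have hneg : ∀ i j, inner ℝ (potForce ψ (x j t - x i t)) (x' i)
      = -inner ℝ (x' i) (potForce ψ (x i t - x j t)) := fun i j => by
    rw [← neg_sub, potForce_neg, inner_neg_left, real_inner_comm]
  simp only [hneg, real_inner_comm (x' _), Finset.sum_neg_distrib]
  ring

/-- The proxy energy grows at most at the rate of the power of the delayed forces, up to terms that
sufficient damping dominates. -/
lemma exists_hasDerivWithinAt_proxyEnergy {ψ : ℝ → ℝ} {rhat D : ℝ} (hψ : IsPotential ψ rhat D)
    (hrD : rhat ≤ D) {ζ ϑ a : ℝ} (hζ : 0 ≤ ζ) (hϑ : 0 ≤ ϑ) (ha : 0 < a)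
    (hlip : ∀ u u' : Vec n, ‖u‖ ≤ rhat → ‖u'‖ ≤ D → ∀ l,
      |potForce ψ u l - potForce ψ u' l| ≤ ζ * |u l - u' l| + ϑ * ‖u - u'‖)
    {Tbar : Fin N → Fin N → ℝ} {T : Fin N → Fin N → ℝ} {x w : Fin N → ℝ → Vec n} {S : Set ℝ}
    {t : ℝ} (hw : ∀ i, Continuous (w i)) (hx : ∀ i t, HasDerivAt (x i) (w i t) t)
    (hT : ∀ i j, G.Adj i j → 0 ≤ T i j ∧ T i j ≤ Tbar i j)
    (hdist : ∀ i j, G.Adj i j → ‖x i t - x j t‖ ≤ rhat)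
    (hdelay : ∀ i j, G.Adj i j → ‖x i t - x j (t - T j i)‖ ≤ D) :
    ∃ d ≤ ∑ i, (inner ℝ (w i t) (∑ j ∈ G.neighborFinset i,
          gradPot ψ (x i t) (x j (t - T j i)))
        + (∑ j ∈ G.neighborFinset i,
          (a * (ζ + ϑ) / 2 + (ζ + n * ϑ) * Tbar i j ^ 2 / (2 * a))) * ‖w i t‖ ^ 2),
      HasDerivWithinAt (proxyEnergy G ψ ((ζ + n * ϑ) / (2 * a)) Tbar x w) d S t := by
  set κ := (ζ + n * ϑ) / (2 * a) with hκdef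
  have hκ : 0 ≤ κ := by positivity
  have h1 := hasDerivWithinAt_totalPot (S := S) hψ (fun i => (hx i t).hasDerivWithinAt)
    (fun i j h => (hdist i j h).trans hrD)
  have h2 : HasDerivWithinAt (fun t => ∑ i, ∑ j ∈ G.neighborFinset i,
      κ * (Tbar j i * delayEnergy (w j) (Tbar j i) t)) _ S t :=
    HasDerivWithinAt.fun_sum fun i _ => HasDerivWithinAt.fun_sum fun j _ =>
      (((hasDerivAt_delayEnergy (hw j) (Tbar j i) t).hasDerivWithinAt.const_mul
        (Tbar j i)).const_mul κ)
  refine ⟨_, ?_, h1.add h2⟩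
  rw [← Finset.sum_add_distrib]
  simp only [← Finset.sum_add_distrib]
  -- power of the undelayed force against that of the delayed one, edge by edge
  have hedge : ∀ i j, G.Adj i j →
      inner ℝ (w i t) (potForce ψ (x i t - x j t)) + κ * (Tbar j i * (Tbar j i * ‖w j t‖ ^ 2
          - (velEnergy (w j) t - velEnergy (w j) (t - Tbar j i))))
        ≤ inner ℝ (w i t) (gradPot ψ (x i t) (x j (t - T j i)))
          + a * (ζ + ϑ) / 2 * ‖w i t‖ ^ 2 + κ * Tbar j i ^ 2 * ‖w j t‖ ^ 2 := fun i j hij => by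
    rw [hψ.gradPot_eq (hdelay i j hij)]
    have hΔ : (x i t - x j t) - (x i t - x j (t - T j i)) = -(x j t - x j (t - T j i)) := by abel
    have hp := inner_le_of_abs_le (f := potForce ψ (x i t - x j t)
      - potForce ψ (x i t - x j (t - T j i)))
      (Δ := (x i t - x j t) - (x i t - x j (t - T j i))) hζ hϑ ha
      (hlip _ _ (hdist i j hij) (hdelay i j hij)) (w i t)
    rw [hΔ, norm_neg, inner_sub_right, ← hκdef] at hp
    have hcs := mul_le_mul_of_nonneg_left (norm_sub_delay_sq_le (hw j) (hx j)
      (hT j i hij.symm).1 (hT j i hij.symm).2 t) hκ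
    nlinarith
  refine (Finset.sum_le_sum fun i _ => Finset.sum_le_sum fun j hj =>
    hedge i j ((G.mem_neighborFinset i j).1 hj)).trans (le_of_eq ?_)
  simp only [Finset.sum_add_distrib]
  rw [sum_neighborFinset_comm G fun i j => κ * Tbar j i ^ 2 * ‖w j t‖ ^ 2]
  simp only [inner_sum, add_mul, Finset.sum_mul, Finset.sum_add_distrib, hκdef]
  rw [add_assoc]
  congr 2
  exact Finset.sum_congr rfl fun i _ => Finset.sum_congr rfl fun j _ => by ring

end Network

/-! ### Consensus of the proxies -/

lemma norm_sub_delay_le {n : ℕ} {x w : ℝ → Vec n} (hx : ∀ t, HasDerivAt x (w t) t) {c s t : ℝ}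
    (hs : 0 ≤ s) (hw : ∀ σ, t - s ≤ σ → σ < t → ‖w σ‖ ≤ c) : ‖x t - x (t - s)‖ ≤ c * s := by
  have := norm_image_sub_le_of_norm_deriv_le_segment' (a := t - s) (b := t) (C := c)
    (fun σ _ => (hx σ).hasDerivWithinAt) (fun σ hσ => hw σ hσ.1 hσ.2) t ⟨by linarith, le_rfl⟩
  simpa using this

/-- If the velocity vanishes asymptotically, so does the displacement over a bounded delay. -/
lemma tendsto_sub_delay {n : ℕ} {x w : ℝ → Vec n} (hx : ∀ t, HasDerivAt x (w t) t)
    (hw : Tendsto w atTop (𝓝 0)) {T : ℝ → ℝ} {τ : ℝ} (hT : ∀ t ≥ 0, 0 ≤ T t ∧ T t ≤ τ) :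
    Tendsto (fun t => x t - x (t - T t)) atTop (𝓝 0) := by
  have hτ : 0 ≤ τ := (hT 0 le_rfl).1.trans (hT 0 le_rfl).2
  rw [Metric.tendsto_atTop']
  intro η hη
  have hc : 0 < η / (2 * (τ + 1)) := by positivity
  obtain ⟨t₀, ht₀⟩ := eventually_atTop.1
    ((tendsto_zero_iff_norm_tendsto_zero.1 hw).eventually (gt_mem_nhds hc))
  refine ⟨max 0 (t₀ + τ), fun t ht => ?_⟩
  obtain ⟨h0, h1⟩ := max_lt_iff.1 ht
  obtain ⟨hT0, hT1⟩ := hT t h0.le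
  have h2 := norm_sub_delay_le hx hT0 (c := η / (2 * (τ + 1))) (t := t)
    fun σ hσ _ => (ht₀ σ (by linarith)).le
  rw [dist_zero_right]
  refine h2.trans_lt ?_
  rw [div_mul_eq_mul_div, div_lt_iff₀ (by positivity)]
  nlinarith

/-- In a preconnected graph, every reflexive transitive relation that contains adjacency relates all
vertices. -/
lemma SimpleGraph.Preconnected.forall_of_adj {V : Type*} {G : SimpleGraph V} (hG : G.Preconnected)
    {P : V → V → Prop} (hrefl : ∀ i, P i i) (htrans : ∀ i j k, P i j → P j k → P i k)
    (hadj : ∀ i j, G.Adj i j → P i j) (i j : V) : P i j := by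
  obtain ⟨p⟩ := hG i j
  induction p with
  | nil => exact hrefl _
  | cons h _ ih => exact htrans _ _ _ (hadj _ _ h) ih

section Force

variable {n : ℕ} {ψ : ℝ → ℝ} {rhat D ζ ϑ : ℝ}

/-- The Lipschitz-type bound on pairwise gradients as a bound on the force as a function of the
relative position. -/
lemma abs_potForce_sub_le (hψ : IsPotential ψ rhat D) (hrD : rhat ≤ D) (hϑ : 0 ≤ ϑ)
    (hgrad : ∀ xi xj xjd : Vec n, ‖xi - xj‖ ≤ rhat → ‖xi - xjd‖ ≤ D →
      ∀ l, |gradPot ψ xi xj l - gradPot ψ xi xjd l|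
        ≤ ζ * |xj l - xjd l| + ϑ * ‖(fun l' => xj l' - xjd l' : Fin n → ℝ)‖)
    (u u' : Vec n) (hu : ‖u‖ ≤ rhat) (hu' : ‖u'‖ ≤ D) (l : Fin n) :
    |potForce ψ u l - potForce ψ u' l| ≤ ζ * |u l - u' l| + ϑ * ‖u - u'‖ := by
  have h := hgrad 0 (-u) (-u') (by simpa using hu) (by simpa using hu') l
  rw [hψ.gradPot_eq (by simpa using hu.trans hrD), hψ.gradPot_eq (by simpa using hu')] at h
  simp only [zero_sub, neg_neg, PiLp.neg_apply] at h
  have h1 : |-u l - -u' l| = |u l - u' l| := by rw [← abs_neg]; congr 1; ring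
  have h2 : ‖(fun l' => -u l' - -u' l' : Fin n → ℝ)‖ ≤ ‖u - u'‖ := by
    refine (pi_norm_le_iff_of_nonneg (norm_nonneg _)).2 fun l' => ?_
    have : -u l' - -u' l' = -((u - u') l') := by rw [PiLp.sub_apply]; ring
    rw [this, norm_neg]
    exact abs_apply_le_norm (u - u') l'
  rw [h1] at h
  exact h.trans (by gcongr)

lemma norm_potForce_sub_le (hζ : 0 ≤ ζ) (hϑ : 0 ≤ ϑ)
    (hlip : ∀ u u' : Vec n, ‖u‖ ≤ rhat → ‖u'‖ ≤ D → ∀ l,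
      |potForce ψ u l - potForce ψ u' l| ≤ ζ * |u l - u' l| + ϑ * ‖u - u'‖)
    {u u' : Vec n} (hu : ‖u‖ ≤ rhat) (hu' : ‖u'‖ ≤ D) :
    ‖potForce ψ u - potForce ψ u'‖ ≤ n * (ζ + ϑ) * ‖u - u'‖ := by
  rw [mul_assoc]
  refine norm_le_of_forall_abs_le (by positivity) fun l => (hlip u u' hu hu' l).trans ?_
  rw [add_mul]
  exact add_le_add_left (mul_le_mul_of_nonneg_left (abs_apply_le_norm (u - u') l) hζ) _

lemma continuousOn_potForce (hζ : 0 ≤ ζ) (hϑ : 0 ≤ ϑ) (hrD : rhat ≤ D)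
    (hlip : ∀ u u' : Vec n, ‖u‖ ≤ rhat → ‖u'‖ ≤ D → ∀ l,
      |potForce ψ u l - potForce ψ u' l| ≤ ζ * |u l - u' l| + ϑ * ‖u - u'‖) :
    ContinuousOn (potForce ψ : Vec n → Vec n) (Metric.closedBall 0 rhat) := by
  have : LipschitzOnWith (Real.toNNReal (n * (ζ + ϑ))) (potForce ψ : Vec n → Vec n)
      (Metric.closedBall 0 rhat) := by
    refine LipschitzOnWith.of_dist_le_mul fun u hu u' hu' => ?_
    rw [dist_eq_norm, dist_eq_norm, Real.coe_toNNReal _ (by positivity)]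
    exact norm_potForce_sub_le hζ hϑ hlip (mem_closedBall_zero_iff.1 hu)
      ((mem_closedBall_zero_iff.1 hu').trans hrD)
  exact this.continuousOn

end Force

section Consensus

variable {N n : ℕ} {G : SimpleGraph (Fin N)} [DecidableRel G.Adj]

/-- The power of all coupling forces relative to a common reference point. -/
lemma sum_inner_potForce_eq (ψ : ℝ → ℝ) (x : Fin N → Vec n) (z : Vec n) :
    ∑ i, ∑ j ∈ G.neighborFinset i, inner ℝ (x i - x j) (potForce ψ (x i - x j))
      = 2 * ∑ i, inner ℝ (x i - z) (∑ j ∈ G.neighborFinset i, potForce ψ (x i - x j)) := by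
  have h1 : ∀ i j, inner ℝ (x i - x j) (potForce ψ (x i - x j))
      = inner ℝ (x i - z) (potForce ψ (x i - x j))
        - inner ℝ (x j - z) (potForce ψ (x i - x j)) := fun i j => by
    rw [← inner_sub_left, sub_sub_sub_cancel_right]
  have h2 : ∀ i j, inner ℝ (x i - z) (potForce ψ (x j - x i))
      = -inner ℝ (x i - z) (potForce ψ (x i - x j)) := fun i j => by
    rw [← neg_sub (x i) (x j), potForce_neg, inner_neg_right]
  simp only [h1, Finset.sum_sub_distrib, inner_sum]
  rw [sum_neighborFinset_comm G fun i j => inner ℝ (x j - z) (potForce ψ (x i - x j))]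
  simp only [h2, Finset.sum_neg_distrib]
  ring

/-- If the net coupling forces vanish asymptotically on a connected graph, the proxies reach
consensus. -/
lemma tendsto_sub_of_tendsto_force {ψ : ℝ → ℝ} {rhat D : ℝ} (hG : G.Connected)
    (hψ : IsPotential ψ rhat D)
    (hc : ContinuousOn (potForce ψ : Vec n → Vec n) (Metric.closedBall 0 rhat))
    {x : Fin N → ℝ → Vec n} (hdist : ∀ i j, G.Adj i j → ∀ t ≥ 0, ‖x i t - x j t‖ ≤ rhat)
    (hF : ∀ i, Tendsto (fun t => ∑ j ∈ G.neighborFinset i, potForce ψ (x i t - x j t)) atTop (𝓝 0))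
    (i j : Fin N) : Tendsto (fun t => x i t - x j t) atTop (𝓝 0) := by
  have hbdd : ∀ i j, ∃ R, ∀ t ≥ 0, ‖x i t - x j t‖ ≤ R := by
    refine hG.preconnected.forall_of_adj (fun i => ⟨0, fun t _ => by simp⟩) ?_
      fun i j h => ⟨rhat, hdist i j h⟩
    rintro i j k ⟨R, hR⟩ ⟨R', hR'⟩
    refine ⟨R + R', fun t ht => ?_⟩
    rw [← sub_add_sub_cancel _ (x j t)]
    exact (norm_add_le _ _).trans (add_le_add (hR t ht) (hR' t ht))
  obtain ⟨i₀⟩ := hG.nonempty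
  have hsum : Tendsto (fun t => ∑ i, ∑ j ∈ G.neighborFinset i,
      inner ℝ (x i t - x j t) (potForce ψ (x i t - x j t))) atTop (𝓝 0) := by
    simp only [fun t => sum_inner_potForce_eq (G := G) ψ (fun i => x i t) (x i₀ t)]
    suffices h : Tendsto (fun t => ∑ i, inner ℝ (x i t - x i₀ t)
        (∑ j ∈ G.neighborFinset i, potForce ψ (x i t - x j t))) atTop (𝓝 0) by
      simpa using h.const_mul 2
    rw [← Finset.sum_const_zero (M := ℝ) (ι := Fin N) (s := Finset.univ)]
    refine tendsto_finsetSum _ fun i _ => ?_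
    obtain ⟨R, hR⟩ := hbdd i i₀
    have h := (tendsto_zero_iff_norm_tendsto_zero.1 (hF i)).const_mul R
    rw [mul_zero] at h
    refine squeeze_zero_norm' ?_ h
    filter_upwards [eventually_ge_atTop 0] with t ht
    exact (norm_inner_le_norm _ _).trans
      (mul_le_mul_of_nonneg_right (hR t ht) (norm_nonneg _))
  refine hG.preconnected.forall_of_adj (P := fun i j => Tendsto (fun t => x i t - x j t) atTop (𝓝 0))
    (fun i => by simp) (fun i j k h1 h2 => by simpa using h1.add h2) (fun i j hij => ?_) i j
  rw [Metric.tendsto_atTop']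
  intro η hη
  obtain ⟨c, hcpos, hcle⟩ := hψ.exists_pos_le_inner_potForce hc hη
  obtain ⟨t₀, ht₀⟩ := eventually_atTop.1
    ((hsum.eventually (gt_mem_nhds hcpos)).and (eventually_ge_atTop 0))
  refine ⟨t₀, fun t ht => ?_⟩
  obtain ⟨hlt, ht0⟩ := ht₀ t ht.le
  rw [dist_zero_right]
  by_contra! hge
  have h0 : ∀ i j, j ∈ G.neighborFinset i →
      0 ≤ inner ℝ (x i t - x j t) (potForce ψ (x i t - x j t)) := fun i j hj =>
    hψ.inner_potForce_nonneg (hdist i j ((G.mem_neighborFinset i j).1 hj) t ht0)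
  have h1 := Finset.single_le_sum (f := fun j =>
    inner ℝ (x i t - x j t) (potForce ψ (x i t - x j t))) (h0 i) ((G.mem_neighborFinset i j).2 hij)
  have h2 := Finset.single_le_sum (f := fun i => ∑ j ∈ G.neighborFinset i,
    inner ℝ (x i t - x j t) (potForce ψ (x i t - x j t)))
    (fun i _ => Finset.sum_nonneg (h0 i)) (Finset.mem_univ i)
  have h3 := hcle _ hge (hdist i j hij t ht0)
  exact absurd hlt (not_lt.2 (h3.trans (h1.trans h2)))

/-- Consensus of proxies whose velocities and external inputs vanish asymptotically: the velocity
equation then forces the net undelayed coupling forces to vanish. -/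
lemma tendsto_sub_of_proxy_dynamics {ψ : ℝ → ℝ} {rhat D ζ ϑ c : ℝ} (hG : G.Connected)
    (hψ : IsPotential ψ rhat D) (hrD : rhat ≤ D) (hζ : 0 ≤ ζ) (hϑ : 0 ≤ ϑ)
    (hlip : ∀ u u' : Vec n, ‖u‖ ≤ rhat → ‖u'‖ ≤ D → ∀ l,
      |potForce ψ u l - potForce ψ u' l| ≤ ζ * |u l - u' l| + ϑ * ‖u - u'‖)
    {T : Fin N → Fin N → ℝ → ℝ} {Tbar : Fin N → Fin N → ℝ}
    (hT : ∀ i j, G.Adj i j → ∀ t ≥ 0, 0 ≤ T i j t ∧ T i j t ≤ Tbar i j)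
    {k : Fin N → ℝ} {x w u : Fin N → ℝ → Vec n} (hx : ∀ i t, HasDerivAt (x i) (w i t) t)
    (hw : ∀ i, ∀ t ≥ 0, HasDerivWithinAt (w i)
      (u i t - ∑ j ∈ G.neighborFinset i, gradPot ψ (x i t) (x j (t - T j i t)) - k i • w i t)
      (Ici 0) t)
    (hdist : ∀ i j, G.Adj i j → ∀ t ≥ 0, ‖x i t - x j t‖ ≤ rhat)
    (hdelay : ∀ i j, G.Adj i j → ∀ t ≥ 0, ‖x i t - x j (t - T j i t)‖ ≤ D)
    (hwc : ∀ i t, ‖w i t‖ ≤ c) (hw0 : ∀ i, Tendsto (w i) atTop (𝓝 0))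
    (hu0 : ∀ i, Tendsto (u i) atTop (𝓝 0)) (i j : Fin N) :
    Tendsto (fun t => x i t - x j t) atTop (𝓝 0) := by
  refine tendsto_sub_of_tendsto_force hG hψ (continuousOn_potForce hζ hϑ hrD hlip) hdist
    (fun i => ?_) i j
  have hc : 0 ≤ c := (norm_nonneg _).trans (hwc i 0)
  set C := n * (ζ + ϑ) with hC
  have hC0 : 0 ≤ C := by positivity
  have hxlip : ∀ i s, ∀ t ≥ s, ‖x i t - x i s‖ ≤ c * (t - s) := fun i s t hst => by
    simpa using norm_sub_delay_le (hx i) (sub_nonneg.2 hst) (t := t) fun σ _ _ => hwc i σ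
  have key : Tendsto (fun t => -∑ j ∈ G.neighborFinset i, potForce ψ (x i t - x j t))
      atTop (𝓝 0) := by
    refine tendsto_zero_of_hasDerivWithinAt_add (w := w i)
      (B := fun t => u i t - k i • w i t + ∑ j ∈ G.neighborFinset i,
        (potForce ψ (x i t - x j t) - gradPot ψ (x i t) (x j (t - T j i t))))
      (L := ∑ _j ∈ G.neighborFinset i, C * (2 * c)) (fun t ht => ?_) (hw0 i) ?_
      (Finset.sum_nonneg fun _ _ => by positivity) fun s hs t hst => ?_
    · refine (hw i t ht).congr_deriv ?_
      rw [Finset.sum_sub_distrib]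
      abel
    · have h1 := (hu0 i).sub ((hw0 i).const_smul (k i))
      rw [smul_zero, sub_zero] at h1
      rw [← add_zero (0 : Vec n)]
      refine h1.add ?_
      rw [← Finset.sum_const_zero (s := G.neighborFinset i)]
      refine tendsto_finsetSum _ fun j hj => ?_
      have hij := (G.mem_neighborFinset i j).1 hj
      have h2 := (tendsto_zero_iff_norm_tendsto_zero.1
        (tendsto_sub_delay (hx j) (hw0 j) (hT j i hij.symm))).const_mul C
      rw [mul_zero] at h2
      refine squeeze_zero_norm' ?_ h2
      filter_upwards [eventually_ge_atTop 0] with t ht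
      rw [hψ.gradPot_eq (hdelay i j hij t ht)]
      have h3 := norm_potForce_sub_le hζ hϑ hlip (hdist i j hij t ht) (hdelay i j hij t ht)
      rwa [sub_sub_sub_cancel_left, norm_sub_rev (x j (t - T j i t))] at h3
    · rw [neg_sub_neg, ← Finset.sum_sub_distrib, Finset.sum_mul]
      refine norm_sum_le_of_le _ fun j hj => ?_
      have hij := (G.mem_neighborFinset i j).1 hj
      refine (norm_potForce_sub_le hζ hϑ hlip (hdist i j hij s hs)
        ((hdist i j hij t (hs.trans hst)).trans hrD)).trans ?_
      rw [mul_assoc C]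
      refine mul_le_mul_of_nonneg_left ?_ hC0
      calc ‖x i s - x j s - (x i t - x j t)‖ = ‖(x j t - x j s) - (x i t - x i s)‖ := by
            congr 1; abel
        _ ≤ ‖x j t - x j s‖ + ‖x i t - x i s‖ := norm_sub_le _ _
        _ ≤ 2 * c * (t - s) := by linarith [hxlip j s t hst, hxlip i s t hst]
  simpa using key.neg

end Consensus

/-! ### Confinement of closed-loop trajectories -/

section ClosedLoop

variable {N n : ℕ} {m : Fin N → ℕ} {A : (i : Fin N) → ELAgent n (m i)} {K : Design N n m}

lemma phiStar_le (hK : K.Admissible) (hb : ∀ i l, 0 ≤ satBound A K i l) {ρ : ℝ} (i : Fin N)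
    {x : Vec n} (hx : ‖x‖ = ρ) : phiStar A K ρ ≤ couplingEnergy (satBound A K i) (K.p i) x := by
  refine (ciInf_le (Set.finite_range _).bddBelow i).trans (csInf_le ⟨0, ?_⟩ ⟨x, ?_, rfl⟩)
  · rintro _ ⟨y, -, rfl⟩
    exact couplingEnergy_nonneg (hb i) (hK.p_pos i).le y
  · simpa using hx

variable (A K) in
/-- The closed bounds on agents and proxies at time `t`: agent-proxy distance at most `ρ`,
`‖s‖ ≤ √(2 φ* / λ₁)`, proxy speed at most `√(2 φ*)`, and proxies of linked agents within `rhat`. -/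
structure Confined (G : SimpleGraph (Fin N)) (lam₁ : Fin N → ℝ) (ρ rhat : ℝ)
    (q v qh vh : Fin N → ℝ → Vec n) (t : ℝ) : Prop where
  err_le : ∀ i, ‖q i t - qh i t‖ ≤ ρ
  s_le : ∀ i, ‖sVec K i (q i t) (qh i t) (v i t)‖ ≤ Real.sqrt (2 * phiStar A K ρ / lam₁ i)
  vel_le : ∀ i, ‖vh i t‖ ≤ Real.sqrt (2 * phiStar A K ρ)
  dist_le : ∀ i j, G.Adj i j → ‖qh i t - qh j t‖ ≤ rhat

variable (A K) in
/-- The bounds of `Confined` with strict inequalities. -/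
structure StrictlyConfined (G : SimpleGraph (Fin N)) (lam₁ : Fin N → ℝ) (ρ rhat : ℝ)
    (q v qh vh : Fin N → ℝ → Vec n) (t : ℝ) : Prop where
  err_lt : ∀ i, ‖q i t - qh i t‖ < ρ
  s_lt : ∀ i, ‖sVec K i (q i t) (qh i t) (v i t)‖ < Real.sqrt (2 * phiStar A K ρ / lam₁ i)
  vel_lt : ∀ i, ‖vh i t‖ < Real.sqrt (2 * phiStar A K ρ)
  dist_lt : ∀ i j, G.Adj i j → ‖qh i t - qh j t‖ < rhat

lemma StrictlyConfined.confined {G : SimpleGraph (Fin N)} {lam₁ : Fin N → ℝ} {ρ rhat : ℝ}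
    {q v qh vh : Fin N → ℝ → Vec n} {t : ℝ}
    (h : StrictlyConfined A K G lam₁ ρ rhat q v qh vh t) :
    Confined A K G lam₁ ρ rhat q v qh vh t :=
  ⟨fun i => (h.err_lt i).le, fun i => (h.s_lt i).le, fun i => (h.vel_lt i).le,
    fun i j hij => (h.dist_lt i j hij).le⟩

/-- The velocity is recovered from `s` and the agent-proxy displacement. -/
lemma Confined.norm_vel_le {G : SimpleGraph (Fin N)} {lam₁ : Fin N → ℝ} {ρ rhat : ℝ}
    {q v qh vh : Fin N → ℝ → Vec n} {t : ℝ} (h : Confined A K G lam₁ ρ rhat q v qh vh t)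
    (hK : K.Admissible) (i : Fin N) :
    ‖v i t‖ ≤ Real.sqrt (2 * phiStar A K ρ / lam₁ i) + K.α * K.p i * ρ := by
  have hα := hK.α_pos
  have hp := hK.p_pos i
  calc ‖v i t‖ = ‖sVec K i (q i t) (qh i t) (v i t) - (K.α * K.p i) • (q i t - qh i t)‖ := by
        rw [sVec, errVec, smul_smul, add_sub_cancel_right]
    _ ≤ _ := by
        refine (norm_sub_le _ _).trans (add_le_add (h.s_le i) ?_)
        rw [norm_smul, Real.norm_of_nonneg (by positivity)]
        exact mul_le_mul_of_nonneg_left (h.err_le i) (by positivity)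

lemma abs_designedForce_le {i : Fin N} (hb : ∀ l, 0 ≤ satBound A K i l) {q qh v vh : Vec n}
    {θh : Vec (m i)} (h : ∀ l, |regressor A K i q qh v vh θh l| ≤ K.η i l) (l : Fin n) :
    |designedForce A K i q qh v vh θh l| ≤ (A i).fmax l := by
  have h1 := abs_sat_le (hb l) ((K.μ i • sVec K i q qh v + errVec K i q qh) l)
  have h2 : K.η i l + satBound A K i l = (A i).fmax l := by rw [satBound]; ring
  rw [← h2]
  exact (abs_sub _ _).trans (add_le_add (h l) h1)

lemma Sat_eq_self {f : Fin n → ℝ} {x : Vec n} (h : ∀ l, |x l| ≤ f l) : Sat f x = x := by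
  ext l
  exact sat_of_abs_le (h l)

namespace IsClosedLoop

variable {G : SimpleGraph (Fin N)} [DecidableRel G.Adj] {T : Fin N → Fin N → ℝ → ℝ}
  {q v qh vh : Fin N → ℝ → Vec n} {θh : (i : Fin N) → ℝ → Vec (m i)}

lemma continuousOn_vel (h : IsClosedLoop A K G T q v qh vh θh) (i : Fin N) :
    ContinuousOn (v i) (Ici 0) := fun t ht =>
  (h.agent_dyn i t ht).choose_spec.1.continuousWithinAt

lemma continuousOn_proxyVel (h : IsClosedLoop A K G T q v qh vh θh) (i : Fin N) :
    ContinuousOn (vh i) (Ici 0) := fun t ht => (h.proxy_dyn i t ht).continuousWithinAt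

lemma continuousOn_pos (h : IsClosedLoop A K G T q v qh vh θh) (i : Fin N) :
    ContinuousOn (q i) (Ici 0) := fun t ht => (h.agent_vel i t ht).continuousWithinAt

lemma continuousOn_proxy (h : IsClosedLoop A K G T q v qh vh θh) (i : Fin N) :
    ContinuousOn (qh i) (Ici 0) := fun t ht => (h.proxy_vel i t ht).continuousWithinAt

lemma continuousOn_sVec (h : IsClosedLoop A K G T q v qh vh θh) (i : Fin N) :
    ContinuousOn (fun t => sVec K i (q i t) (qh i t) (v i t)) (Ici 0) := by
  have h1 := h.continuousOn_vel i
  have h2 := h.continuousOn_pos i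
  have h3 := h.continuousOn_proxy i
  unfold sVec errVec
  fun_prop

/-- The proxy velocity, continued by its initial value zero to negative times, is continuous. -/
lemma continuous_velExt (h : IsClosedLoop A K G T q v qh vh θh) (i : Fin N) :
    Continuous fun t => vh i (max t 0) :=
  (h.continuousOn_proxyVel i).comp_continuous (by fun_prop) fun _ => mem_Ici.2 (le_max_right _ _)

/-- Since the proxies rest before time zero, their continued velocities are the derivatives of their
positions at all times. -/
lemma hasDerivAt_proxy (h : IsClosedLoop A K G T q v qh vh θh) (i : Fin N) (t : ℝ) :
    HasDerivAt (qh i) (vh i (max t 0)) t := by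
  have hneg : ∀ t ≤ 0, HasDerivWithinAt (qh i) (vh i (max t 0)) (Iic 0) t := fun t ht => by
    rw [max_eq_right ht, h.proxy_rest]
    exact (hasDerivWithinAt_const t (Iic 0) (q i 0)).congr (fun s hs => h.proxy_history i s hs)
      (h.proxy_history i t ht)
  have hpos : ∀ t ≥ 0, HasDerivWithinAt (qh i) (vh i (max t 0)) (Ici 0) t := fun t ht => by
    rw [max_eq_left ht]
    exact h.proxy_vel i t ht
  rcases lt_trichotomy t 0 with ht | rfl | ht
  · exact (hneg t ht.le).hasDerivAt (Iic_mem_nhds ht)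
  · have := (hneg 0 le_rfl).union (hpos 0 le_rfl)
    rwa [Iic_union_Ici, hasDerivWithinAt_univ] at this
  · exact (hpos t ht.le).hasDerivAt (Ici_mem_nhds ht)

lemma hasDerivWithinAt_velExt (h : IsClosedLoop A K G T q v qh vh θh) (i : Fin N) {t : ℝ}
    (ht : 0 ≤ t) : HasDerivWithinAt (fun t => vh i (max t 0))
      (Sat (satBound A K i) (errVec K i (q i t) (qh i t))
        - ∑ j ∈ G.neighborFinset i, gradPot K.ψ (qh i t) (qh j (t - T j i t))
        - K.k i • vh i (max t 0)) (Ici 0) t := by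
  have h1 := h.proxy_dyn i t ht
  rw [max_eq_left ht]
  exact h1.congr (fun s hs => by rw [max_eq_left hs]) (by rw [max_eq_left ht])

lemma estimate_mem (h : IsClosedLoop A K G T q v qh vh θh) (hK : K.Admissible) (i : Fin N) :
    ∀ t ≥ 0, ∀ l, θh i t l ∈ Icc (K.θlo i l) (K.θup i l) :=
  mem_Icc_of_hasDerivWithinAt_Proj hK.δ_pos (h.estimate_dyn i) (h.estimate_init i)

/-- Bounded proxy speeds keep the delayed relative positions within the domain of the potential. -/
lemma norm_sub_delayed_le (h : IsClosedLoop A K G T q v qh vh θh) {lam₁ : Fin N → ℝ}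
    {ρ rhat τ D t : ℝ} (ht : 0 ≤ t)
    (hconf : ∀ s ≥ 0, s ≤ t → Confined A K G lam₁ ρ rhat q v qh vh s) {i j : Fin N}
    (hij : G.Adj i j) (hT : 0 ≤ T j i t ∧ T j i t ≤ τ)
    (hD : rhat + τ * Real.sqrt (2 * phiStar A K ρ) ≤ D) :
    ‖qh i t - qh j (t - T j i t)‖ ≤ D := by
  have h1 := norm_sub_delay_le (h.hasDerivAt_proxy j) hT.1 (t := t)
    (c := Real.sqrt (2 * phiStar A K ρ)) fun σ _ hσ =>
      (hconf _ (le_max_right _ _) (max_le hσ.le ht)).vel_le j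
  have h2 := (hconf t ht le_rfl).dist_le i j hij
  have h3 := mul_le_mul_of_nonneg_left hT.2 (Real.sqrt_nonneg (2 * phiStar A K ρ))
  rw [← sub_add_sub_cancel _ (qh j t)]
  linarith [norm_add_le (qh i t - qh j t) (qh j t - qh j (t - T j i t))]

/-- While an agent is confined, its actuators do not saturate. -/
lemma abs_designedForce_le (h : IsClosedLoop A K G T q v qh vh θh) (hK : K.Admissible)
    {lam₁ : Fin N → ℝ} {ρ rhat : ℝ} {vmax vhmax : Fin N → Fin n → ℝ}
    (hvmax : ∀ i l, Real.sqrt (2 * phiStar A K ρ / lam₁ i) + K.α * K.p i * ρ ≤ vmax i l)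
    (hvhmax : ∀ i l, Real.sqrt (2 * phiStar A K ρ) ≤ vhmax i l)
    (hη : ∀ i, ∀ x xh w wh : Vec n, ∀ θ : Vec (m i), ‖x - xh‖ ≤ ρ →
      (∀ l, |w l| ≤ vmax i l) → (∀ l, |wh l| ≤ vhmax i l) →
      (∀ l, θ l ∈ Icc (K.θlo i l) (K.θup i l)) →
      ∀ l, |(regressor A K i x xh w wh θ) l| ≤ K.η i l)
    (hb : ∀ i l, 0 ≤ satBound A K i l) {t : ℝ} (ht : 0 ≤ t)
    (hconf : Confined A K G lam₁ ρ rhat q v qh vh t) (i : Fin N) (l : Fin n) :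
    |designedForce A K i (q i t) (qh i t) (v i t) (vh i t) (θh i t) l| ≤ (A i).fmax l :=
  _root_.abs_designedForce_le (hb i) (hη i _ _ _ _ _ (hconf.err_le i)
    (fun l => (abs_apply_le_norm _ l).trans ((hconf.norm_vel_le hK i).trans (hvmax i l)))
    (fun l => (abs_apply_le_norm _ l).trans ((hconf.vel_le i).trans (hvhmax i l)))
    (h.estimate_mem hK i t ht)) l

end IsClosedLoop

variable (A K) in
/-- The Lyapunov function of the closed loop. -/
def totalEnergy (G : SimpleGraph (Fin N)) [DecidableRel G.Adj] (κ : ℝ) (Tbar : Fin N → Fin N → ℝ)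
    (q v qh vh : Fin N → ℝ → Vec n) (θh : (i : Fin N) → ℝ → Vec (m i)) (t : ℝ) : ℝ :=
  ∑ i, agentEnergy A K i (q i t) (qh i t) (v i t) (vh i t) (θh i t)
    + proxyEnergy G K.ψ κ Tbar qh (fun i t => vh i (max t 0)) t

variable (A K) in
/-- The power guaranteed to be dissipated by the couplings and the proxy damping. -/
def dissipation (υ : Fin N → ℝ) (q qh vh : Fin N → ℝ → Vec n) (t : ℝ) : ℝ :=
  ∑ i, (K.α * inner ℝ (errVec K i (q i t) (qh i t))
    (Sat (satBound A K i) (errVec K i (q i t) (qh i t))) + υ i * ‖vh i t‖ ^ 2)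

variable {G : SimpleGraph (Fin N)} [DecidableRel G.Adj] {T : Fin N → Fin N → ℝ → ℝ}
  {q v qh vh : Fin N → ℝ → Vec n} {θh : (i : Fin N) → ℝ → Vec (m i)}

lemma dissipation_term_nonneg (hK : K.Admissible) (hb : ∀ i l, 0 ≤ satBound A K i l)
    {υ : Fin N → ℝ} (hυ : ∀ i, 0 < υ i) (i : Fin N) (e w : Vec n) :
    0 ≤ K.α * inner ℝ e (Sat (satBound A K i) e) + υ i * ‖w‖ ^ 2 :=
  add_nonneg (mul_nonneg hK.α_pos.le (inner_Sat_nonneg (hb i) _))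
    (mul_nonneg (hυ i).le (sq_nonneg _))

lemma dissipation_nonneg (hK : K.Admissible) (hb : ∀ i l, 0 ≤ satBound A K i l)
    {υ : Fin N → ℝ} (hυ : ∀ i, 0 < υ i) (t : ℝ) : 0 ≤ dissipation A K υ q qh vh t :=
  Finset.sum_nonneg fun i _ => dissipation_term_nonneg hK hb hυ i _ _

lemma le_dissipation (hK : K.Admissible) (hb : ∀ i l, 0 ≤ satBound A K i l)
    {υ : Fin N → ℝ} (hυ : ∀ i, 0 < υ i) (i : Fin N) (t : ℝ) :
    K.α * inner ℝ (errVec K i (q i t) (qh i t))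
      (Sat (satBound A K i) (errVec K i (q i t) (qh i t))) + υ i * ‖vh i t‖ ^ 2
      ≤ dissipation A K υ q qh vh t :=
  Finset.single_le_sum (f := fun i => K.α * inner ℝ (errVec K i (q i t) (qh i t))
      (Sat (satBound A K i) (errVec K i (q i t) (qh i t))) + υ i * ‖vh i t‖ ^ 2)
    (fun i _ => dissipation_term_nonneg hK hb hυ i _ _) (Finset.mem_univ i)

/-- The delay functionals contribute nonnegatively to the energy of the proxy network. -/
lemma totalPot_le_proxyEnergy {ψ : ℝ → ℝ} {κ : ℝ} {Tbar : Fin N → Fin N → ℝ}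
    {x w : Fin N → ℝ → Vec n} (hκ : 0 ≤ κ) (hTbar : ∀ i j, G.Adj i j → 0 ≤ Tbar i j)
    (hw : ∀ i, Continuous (w i)) (t : ℝ) :
    totalPot G ψ (fun i => x i t) ≤ proxyEnergy G ψ κ Tbar x w t :=
  le_add_of_nonneg_right (Finset.sum_nonneg fun i _ => Finset.sum_nonneg fun j hj => by
    have h := hTbar j i ((G.mem_neighborFinset i j).1 hj).symm
    exact mul_nonneg hκ (mul_nonneg h (delayEnergy_nonneg (hw j) h t)))

/-- The total energy bounds each of its parts. -/
lemma energies_le_totalEnergy (h : IsClosedLoop A K G T q v qh vh θh) {lam₁ lam₂ : Fin N → ℝ}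
    (hEL : ∀ i, (A i).IsEulerLagrange (lam₁ i) (lam₂ i)) (hK : K.Admissible)
    (hb : ∀ i l, 0 ≤ satBound A K i l) {κ : ℝ} {Tbar : Fin N → Fin N → ℝ} (hκ : 0 ≤ κ)
    (hTbar : ∀ i j, G.Adj i j → 0 ≤ Tbar i j) {rhat D : ℝ} (hψ : IsPotential K.ψ rhat D) {t : ℝ}
    (hdist : ∀ i j, G.Adj i j → ‖qh i t - qh j t‖ ≤ rhat) :
    0 ≤ totalEnergy A K G κ Tbar q v qh vh θh t ∧
    (∀ i, agentEnergy A K i (q i t) (qh i t) (v i t) (vh i t) (θh i t)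
      ≤ totalEnergy A K G κ Tbar q v qh vh θh t) ∧
    (∀ i j, G.Adj i j → K.ψ ‖qh i t - qh j t‖ ≤ totalEnergy A K G κ Tbar q v qh vh θh t) := by
  have h0 : ∀ i, 0 ≤ agentEnergy A K i (q i t) (qh i t) (v i t) (vh i t) (θh i t) := fun i =>
    (energies_le_agentEnergy (hEL i) hK (hb i) _ _ _ _ _).1
  have hsum := Finset.sum_nonneg fun i (_ : i ∈ Finset.univ) => h0 i
  have hψ0 : ∀ i j, G.Adj i j → 0 ≤ K.ψ ‖qh i t - qh j t‖ := fun i j hij =>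
    hψ.nonneg _ (norm_nonneg _) (hdist i j hij)
  have hpot := totalPot_nonneg (x := fun i => qh i t) G hψ0
  have hprox := totalPot_le_proxyEnergy (ψ := K.ψ) (x := qh) hκ hTbar h.continuous_velExt t
  unfold totalEnergy
  refine ⟨by linarith, fun i => ?_, fun i j hij => ?_⟩
  · have := Finset.single_le_sum (fun i _ => h0 i) (Finset.mem_univ i)
    linarith
  · have := le_totalPot (x := fun i => qh i t) G hψ0 hij
    linarith

/-- Initially only the parameter errors and the potential contribute to the total energy. -/
lemma totalEnergy_zero (h : IsClosedLoop A K G T q v qh vh θh) {κ : ℝ} {Tbar : Fin N → Fin N → ℝ}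
    (hTbar : ∀ i j, G.Adj i j → 0 ≤ Tbar i j) :
    totalEnergy A K G κ Tbar q v qh vh θh 0
      = ∑ i, ‖(A i).θ - θh i 0‖ ^ 2 / (2 * K.β i) + totalPot G K.ψ (fun i => q i 0) := by
  have h1 : ∀ i, qh i 0 = q i 0 := fun i => h.proxy_history i 0 le_rfl
  have h2 : ∑ i, ∑ j ∈ G.neighborFinset i,
      κ * (Tbar j i * delayEnergy (fun t => vh j (max t 0)) (Tbar j i) 0) = 0 := by
    refine Finset.sum_eq_zero fun i _ => Finset.sum_eq_zero fun j hj => ?_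
    rw [delayEnergy_zero (fun t ht => by rw [max_eq_right ht, h.proxy_rest])
      (hTbar j i ((G.mem_neighborFinset i j).1 hj).symm), mul_zero, mul_zero]
  rw [totalEnergy, proxyEnergy, h2, add_zero]
  simp only [h1]
  congr 1
  refine Finset.sum_congr rfl fun i _ => ?_
  simp [agentEnergy, sVec, errVec, h.agent_rest, h.proxy_rest, couplingEnergy_zero]

/-- While the trajectory is confined and the actuators do not saturate, the total energy is
dissipated. -/
lemma exists_hasDerivWithinAt_totalEnergy (h : IsClosedLoop A K G T q v qh vh θh)
    {lam₁ lam₂ : Fin N → ℝ} (hEL : ∀ i, (A i).IsEulerLagrange (lam₁ i) (lam₂ i))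
    (hK : K.Admissible)
    (hθ : ∀ i l, (A i).θ l ∈ Icc (K.θlo i l + K.δ) (K.θup i l - K.δ))
    {Tbar : Fin N → Fin N → ℝ} {rhat D ζ ϑ a : ℝ} (hψ : IsPotential K.ψ rhat D) (hrD : rhat ≤ D)
    (hζ : 0 ≤ ζ) (hϑ : 0 ≤ ϑ) (ha : 0 < a)
    (hlip : ∀ u u' : Vec n, ‖u‖ ≤ rhat → ‖u'‖ ≤ D → ∀ l,
      |potForce K.ψ u l - potForce K.ψ u' l| ≤ ζ * |u l - u' l| + ϑ * ‖u - u'‖)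
    {υ : Fin N → ℝ} (hk : ∀ i, ∑ j ∈ G.neighborFinset i,
        (a * (ζ + ϑ) / 2 + (ζ + n * ϑ) * Tbar i j ^ 2 / (2 * a)) + υ i ≤ K.k i)
    {t : ℝ} (ht : 0 ≤ t) (hT : ∀ i j, G.Adj i j → 0 ≤ T i j t ∧ T i j t ≤ Tbar i j)
    (hforce : ∀ i l,
      |designedForce A K i (q i t) (qh i t) (v i t) (vh i t) (θh i t) l| ≤ (A i).fmax l)
    (hdist : ∀ i j, G.Adj i j → ‖qh i t - qh j t‖ ≤ rhat)
    (hdelay : ∀ i j, G.Adj i j → ‖qh i t - qh j (t - T j i t)‖ ≤ D) :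
    ∃ d ≤ -dissipation A K υ q qh vh t, HasDerivWithinAt
      (totalEnergy A K G ((ζ + n * ϑ) / (2 * a)) Tbar q v qh vh θh) d (Ici 0) t := by
  choose acc hacc hdyn using fun i => h.agent_dyn i t ht
  simp only [Sat_eq_self (hforce _)] at hdyn
  choose d hd hder using fun i => exists_hasDerivWithinAt_agentEnergy (hEL i) hK (hθ i)
    (h.agent_vel i t ht) (hacc i) (hdyn i) (h.estimate_dyn i t ht) (h.proxy_vel i t ht)
    (h.proxy_dyn i t ht)
  obtain ⟨d', hd', hder'⟩ := exists_hasDerivWithinAt_proxyEnergy (S := Ici 0) (t := t) hψ hrD hζ hϑ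
    ha hlip h.continuous_velExt h.hasDerivAt_proxy hT hdist hdelay
  refine ⟨_, ?_, (HasDerivWithinAt.fun_sum fun i _ => hder i).add hder'⟩
  refine (add_le_add (Finset.sum_le_sum fun i _ => hd i) hd').trans ?_
  rw [dissipation, ← Finset.sum_add_distrib, ← Finset.sum_neg_distrib, max_eq_left ht]
  refine Finset.sum_le_sum fun i _ => ?_
  have := mul_le_mul_of_nonneg_right (hk i) (sq_nonneg ‖vh i t‖)
  rw [add_mul] at this
  linarith

/-- Total energy below the maximal potential turns the bounds of confinement into strict ones. -/
lemma Confined.strictlyConfined (h : IsClosedLoop A K G T q v qh vh θh) {lam₁ lam₂ : Fin N → ℝ}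
    (hEL : ∀ i, (A i).IsEulerLagrange (lam₁ i) (lam₂ i)) (hK : K.Admissible)
    (hb : ∀ i l, 0 ≤ satBound A K i l) {κ : ℝ} {Tbar : Fin N → Fin N → ℝ} (hκ : 0 ≤ κ)
    (hTbar : ∀ i j, G.Adj i j → 0 ≤ Tbar i j) {ρ rhat D : ℝ} (hψ : IsPotential K.ψ rhat D)
    (hψmax : K.ψ rhat ≤ phiStar A K ρ) {t : ℝ}
    (herr : ∀ i, ‖q i t - qh i t‖ ≤ ρ) (hdist : ∀ i j, G.Adj i j → ‖qh i t - qh j t‖ ≤ rhat)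
    (hE : totalEnergy A K G κ Tbar q v qh vh θh t < K.ψ rhat) :
    StrictlyConfined A K G lam₁ ρ rhat q v qh vh t := by
  obtain ⟨-, hag, hpot⟩ := energies_le_totalEnergy h hEL hK hb hκ hTbar hψ hdist
  have hparts := fun i => energies_le_agentEnergy (hEL i) hK (hb i) (q i t) (qh i t) (v i t)
    (vh i t) (θh i t)
  refine ⟨fun i => (herr i).lt_of_ne fun he => ?_, fun i => ?_, fun i => ?_,
    fun i j hij => (hdist i j hij).lt_of_ne fun he => ?_⟩
  · have := phiStar_le hK hb i he
    linarith [hag i, (hparts i).2.2.1]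
  · refine Real.lt_sqrt_of_sq_lt ?_
    rw [lt_div_iff₀ (hEL i).lam₁_pos]
    linarith [hag i, (hparts i).2.1]
  · refine Real.lt_sqrt_of_sq_lt ?_
    linarith [hag i, (hparts i).2.2.2]
  · have := hpot i j hij
    rw [he] at this
    linarith

/-- Strict confinement is an open condition along closed-loop trajectories. -/
lemma StrictlyConfined.eventually (h : IsClosedLoop A K G T q v qh vh θh) {lam₁ : Fin N → ℝ}
    {ρ rhat t : ℝ} (ht : 0 ≤ t) (hc : StrictlyConfined A K G lam₁ ρ rhat q v qh vh t) :
    ∀ᶠ s in 𝓝[≥] t, StrictlyConfined A K G lam₁ ρ rhat q v qh vh s := by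
  have hlt : ∀ {f : ℝ → Vec n} {c : ℝ}, ContinuousOn f (Ici 0) → ‖f t‖ < c →
      ∀ᶠ s in 𝓝[≥] t, ‖f s‖ < c := fun hf hlt =>
    (((hf t ht).mono (Ici_subset_Ici.2 ht)).norm).eventually (gt_mem_nhds hlt)
  have h1 := eventually_all.2 fun i =>
    hlt ((h.continuousOn_pos i).sub (h.continuousOn_proxy i)) (hc.err_lt i)
  have h2 := eventually_all.2 fun i => hlt (h.continuousOn_sVec i) (hc.s_lt i)
  have h3 := eventually_all.2 fun i => hlt (h.continuousOn_proxyVel i) (hc.vel_lt i)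
  have h4 : ∀ᶠ s in 𝓝[≥] t, ∀ i j, G.Adj i j → ‖qh i s - qh j s‖ < rhat :=
    eventually_all.2 fun i => eventually_all.2 fun j => eventually_imp_distrib_left.2 fun hij =>
      hlt ((h.continuousOn_proxy i).sub (h.continuousOn_proxy j)) (hc.dist_lt i j hij)
  filter_upwards [h1, h2, h3, h4] with s h1 h2 h3 h4
  exact ⟨h1, h2, h3, h4⟩

/-- Confinement strictly before a positive time extends to that time. -/
lemma Confined.of_forall_lt (h : IsClosedLoop A K G T q v qh vh θh) {lam₁ : Fin N → ℝ}
    {ρ rhat t : ℝ} (ht : 0 < t)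
    (hc : ∀ s ≥ 0, s < t → Confined A K G lam₁ ρ rhat q v qh vh s) :
    Confined A K G lam₁ ρ rhat q v qh vh t :=
  ⟨fun i => le_of_forall_lt_le ((h.continuousOn_pos i).sub (h.continuousOn_proxy i)).norm ht
      fun s hs hst => (hc s hs hst).err_le i,
    fun i => le_of_forall_lt_le (h.continuousOn_sVec i).norm ht
      fun s hs hst => (hc s hs hst).s_le i,
    fun i => le_of_forall_lt_le (h.continuousOn_proxyVel i).norm ht
      fun s hs hst => (hc s hs hst).vel_le i,
    fun i j hij => le_of_forall_lt_le
      ((h.continuousOn_proxy i).sub (h.continuousOn_proxy j)).norm ht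
      fun s hs hst => (hc s hs hst).dist_le i j hij⟩

end ClosedLoop

/-! ### Asymptotic behaviour of confined trajectories -/

lemma norm_sub_le_of_hasDerivWithinAt_Ici {E : Type*} [NormedAddCommGroup E] [NormedSpace ℝ E]
    {g g' : ℝ → E} {C : ℝ} (hg : ∀ t ≥ 0, HasDerivWithinAt g (g' t) (Ici 0) t)
    (hC : ∀ t ≥ 0, ‖g' t‖ ≤ C) : ∀ s ≥ 0, ∀ t ≥ s, ‖g t - g s‖ ≤ C * (t - s) :=
  fun _ hs t hst => norm_image_sub_le_of_norm_deriv_le_segment'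
    (fun x hx => (hg x (hs.trans hx.1)).mono fun _ hy => hs.trans hy.1)
    (fun x hx => hC x (hs.trans hx.1)) t ⟨hst, le_rfl⟩

lemma tendsto_vec_zero {n : ℕ} {x : ℝ → Vec n} (h : ∀ l, Tendsto (fun t => x t l) atTop (𝓝 0)) :
    Tendsto x atTop (𝓝 0) :=
  ((PiLp.continuous_toLp 2 _).tendsto _).comp
    (tendsto_pi_nhds.2 h : Tendsto (fun t l => x t l) atTop (𝓝 0))

section Asymptotics

variable {N n : ℕ} {m : Fin N → ℕ} {A : (i : Fin N) → ELAgent n (m i)} {K : Design N n m}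
  {G : SimpleGraph (Fin N)} [DecidableRel G.Adj] {T : Fin N → Fin N → ℝ → ℝ}
  {q v qh vh : Fin N → ℝ → Vec n} {θh : (i : Fin N) → ℝ → Vec (m i)} {W : ℝ → ℝ}
  {υ : Fin N → ℝ} {lam₁ : Fin N → ℝ} {ρ rhat : ℝ}

/-- The agents converge to their proxies: the relative velocity is bounded, and the saturated
couplings dissipate energy as long as a component of the displacement is not small. -/
lemma tendsto_err (h : IsClosedLoop A K G T q v qh vh θh) (hK : K.Admissible)
    (hb : ∀ i l, 0 < satBound A K i l) (hυ : ∀ i, 0 < υ i)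
    (hconf : ∀ t ≥ 0, Confined A K G lam₁ ρ rhat q v qh vh t)
    (hW0 : ∀ t ≥ 0, 0 ≤ W t)
    (hW : ∀ t ≥ 0, ∃ d ≤ -dissipation A K υ q qh vh t, HasDerivWithinAt W d (Ici 0) t)
    (i : Fin N) : Tendsto (fun t => q i t - qh i t) atTop (𝓝 0) := by
  have hb' : ∀ i l, 0 ≤ satBound A K i l := fun i l => (hb i l).le
  have hp := hK.p_pos i
  have hα := hK.α_pos
  refine tendsto_vec_zero fun l => ?_
  have hder : ∀ t ≥ 0, HasDerivWithinAt (fun t => (q i t - qh i t) l) ((v i t - vh i t) l)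
      (Ici 0) t := fun t ht => ((h.agent_vel i t ht).sub (h.proxy_vel i t ht)).vec_apply l
  have hbound : ∀ t ≥ 0, ‖(v i t - vh i t) l‖ ≤ (Real.sqrt (2 * phiStar A K ρ / lam₁ i)
      + K.α * K.p i * ρ) + Real.sqrt (2 * phiStar A K ρ) := fun t ht =>
    (abs_apply_le_norm _ l).trans ((norm_sub_le _ _).trans
      (add_le_add ((hconf t ht).norm_vel_le hK i) ((hconf t ht).vel_le i)))
  refine tendsto_zero_of_dissipation hW0 (fun t _ => dissipation_nonneg hK hb' hυ t) hW
    ((norm_nonneg _).trans (hbound 0 le_rfl)) (norm_sub_le_of_hasDerivWithinAt_Ici hder hbound)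
    fun η hη => ⟨K.α * (K.p i * η * min (K.p i * η) (satBound A K i l)), ?_, fun t _ hge => ?_⟩
  · have := lt_min (mul_pos hp hη) (hb i l)
    positivity
  · refine le_trans ?_ (le_dissipation hK hb' hυ i t)
    refine le_add_of_le_of_nonneg (mul_le_mul_of_nonneg_left ?_ hα.le)
      (mul_nonneg (hυ i).le (sq_nonneg _))
    refine le_trans ?_ (mul_sat_le_inner_Sat (hb' i) _ l)
    refine le_mul_sat (by positivity) (hb' i l) ?_
    have : errVec K i (q i t) (qh i t) l = K.p i * (q i t - qh i t) l := rfl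
    rw [this, abs_mul, abs_of_pos hp]
    exact mul_le_mul_of_nonneg_left hge hp.le

/-- The proxies come to rest: their accelerations are bounded, and their damping dissipates energy
as long as they move. -/
lemma tendsto_proxyVel (h : IsClosedLoop A K G T q v qh vh θh) (hK : K.Admissible)
    (hb : ∀ i l, 0 ≤ satBound A K i l) (hυ : ∀ i, 0 < υ i) {D ζ ϑ : ℝ}
    (hψ : IsPotential K.ψ rhat D) (hζ : 0 ≤ ζ) (hϑ : 0 ≤ ϑ)
    (hlip : ∀ u u' : Vec n, ‖u‖ ≤ rhat → ‖u'‖ ≤ D → ∀ l,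
      |potForce K.ψ u l - potForce K.ψ u' l| ≤ ζ * |u l - u' l| + ϑ * ‖u - u'‖)
    (hconf : ∀ t ≥ 0, Confined A K G lam₁ ρ rhat q v qh vh t)
    (hdelay : ∀ i j, G.Adj i j → ∀ t ≥ 0, ‖qh i t - qh j (t - T j i t)‖ ≤ D)
    (hW0 : ∀ t ≥ 0, 0 ≤ W t)
    (hW : ∀ t ≥ 0, ∃ d ≤ -dissipation A K υ q qh vh t, HasDerivWithinAt W d (Ici 0) t)
    (i : Fin N) : Tendsto (vh i) atTop (𝓝 0) := by
  have hk := hK.k_pos i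
  have hp := hK.p_pos i
  have hbound : ∀ t ≥ 0, ‖Sat (satBound A K i) (errVec K i (q i t) (qh i t))
      - ∑ j ∈ G.neighborFinset i, gradPot K.ψ (qh i t) (qh j (t - T j i t)) - K.k i • vh i t‖
      ≤ K.p i * ρ + ∑ _j ∈ G.neighborFinset i, n * (ζ + ϑ) * D
        + K.k i * Real.sqrt (2 * phiStar A K ρ) := fun t ht => by
    refine (norm_sub_le _ _).trans (add_le_add ((norm_sub_le _ _).trans (add_le_add ?_ ?_)) ?_)
    · refine (norm_Sat_le (hb i) _).trans ?_
      rw [errVec, norm_smul, Real.norm_of_nonneg hp.le]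
      exact mul_le_mul_of_nonneg_left ((hconf t ht).err_le i) hp.le
    · refine norm_sum_le_of_le _ fun j hj => ?_
      have hij := (G.mem_neighborFinset i j).1 hj
      have hd := hdelay i j hij t ht
      -- the force vanishes at coincidence, so its Lipschitz bound is a bound on its size
      have h1 := norm_potForce_sub_le hζ hϑ hlip (u := 0)
        (by rw [norm_zero]; exact (norm_nonneg _).trans ((hconf t ht).dist_le i j hij)) hd
      rw [potForce_zero, zero_sub, zero_sub, norm_neg, norm_neg] at h1
      rw [hψ.gradPot_eq hd]
      exact h1.trans (mul_le_mul_of_nonneg_left hd (by positivity))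
    · rw [norm_smul, Real.norm_of_nonneg hk.le]
      exact mul_le_mul_of_nonneg_left ((hconf t ht).vel_le i) hk.le
  refine tendsto_zero_of_dissipation hW0 (fun t _ => dissipation_nonneg hK hb hυ t) hW
    ((norm_nonneg _).trans (hbound 0 le_rfl))
    (norm_sub_le_of_hasDerivWithinAt_Ici (h.proxy_dyn i) hbound)
    fun η hη => ⟨υ i * η ^ 2, mul_pos (hυ i) (pow_pos hη 2), fun t _ hge => ?_⟩
  refine le_trans ?_ (le_dissipation hK hb hυ i t)
  exact le_add_of_nonneg_of_le (mul_nonneg hK.α_pos.le (inner_Sat_nonneg (hb i) _))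
    (mul_le_mul_of_nonneg_left (pow_le_pow_left₀ hη.le hge 2) (hυ i).le)

end Asymptotics

end

/-! ### Connectivity preservation and consensus -/

theorem mainTheorem2 {N n : ℕ} {m : Fin N → ℕ}
    -- Euler-Lagrange agents with bounded actuation
    (A : (i : Fin N) → ELAgent n (m i)) (lam₁ lam₂ : Fin N → ℝ)
    (hEL : ∀ i, (A i).IsEulerLagrange (lam₁ i) (lam₂ i))
    -- initial communication graph, communication radius and margin
    (G : SimpleGraph (Fin N)) [DecidableRel G.Adj] (hG : G.Connected)
    (r ε : ℝ) (hr : 0 < r) (hε : 0 < ε)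
    -- delays and their bounds
    (T : Fin N → Fin N → ℝ → ℝ) (Tbar : Fin N → Fin N → ℝ)
    (hT : ∀ i j, G.Adj i j → ∀ t ≥ 0, 0 ≤ T i j t ∧ T i j t ≤ Tbar i j)
    -- gains, and the projection box, whose inner box contains the true parameters
    (K : Design N n m) (hK : K.Admissible)
    (hθ : ∀ i l, (A i).θ l ∈ Icc (K.θlo i l + K.δ) (K.θup i l - K.δ))
    -- the actuators can more than execute the dynamic compensation
    (vmax vhmax : Fin N → Fin n → ℝ)
    (hvmax : ∀ i l, Real.sqrt (2 * phiStar A K (ε / 3) / lam₁ i) + K.α * K.p i * (ε / 3)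
      ≤ vmax i l)
    (hvhmax : ∀ i l, Real.sqrt (2 * phiStar A K (ε / 3)) ≤ vhmax i l)
    (hη : ∀ i, ∀ x xh w wh : Vec n, ∀ θ : Vec (m i), ‖x - xh‖ ≤ ε / 3 →
      (∀ l, |w l| ≤ vmax i l) → (∀ l, |wh l| ≤ vhmax i l) →
      (∀ l, θ l ∈ Icc (K.θlo i l) (K.θup i l)) →
      ∀ l, |(regressor A K i x xh w wh θ) l| ≤ K.η i l)
    (hηf : ∀ i l, K.η i l < (A i).fmax l)
    -- the inter-proxy potential and the Lipschitz-type property of its gradient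
    (D : ℝ) (hD₀ : r - 2 * ε / 3 ≤ D)
    (hD : ∀ i j, G.Adj i j →
      r - 2 * ε / 3 + Tbar i j * Real.sqrt (2 * phiStar A K (ε / 3)) ≤ D)
    (hψ : IsPotential K.ψ (r - 2 * ε / 3) D)
    (hψmax : K.ψ (r - 2 * ε / 3) ≤ phiStar A K (ε / 3))
    (ζ ϑ : ℝ) (hζ : 0 < ζ) (hϑ : 0 < ϑ)
    (hgrad : ∀ xi xj xjd : Vec n, ‖xi - xj‖ ≤ r - 2 * ε / 3 → ‖xi - xjd‖ ≤ D →
      ∀ l, |gradPot K.ψ xi xj l - gradPot K.ψ xi xjd l|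
        ≤ ζ * |xj l - xjd l| + ϑ * ‖(fun l' => xj l' - xjd l' : Fin n → ℝ)‖)
    -- sufficiently large proxy damping
    (a : ℝ) (ha : 0 < a) (υ : Fin N → ℝ) (hυ : ∀ i, 0 < υ i)
    (hk : ∀ i, ∑ j ∈ G.neighborFinset i,
        (a * (ζ + ϑ) / 2 + (ζ + n * ϑ) * Tbar i j ^ 2 / (2 * a)) + υ i ≤ K.k i)
    -- a closed-loop trajectory from rest
    (q v qh vh : Fin N → ℝ → Vec n) (θh : (i : Fin N) → ℝ → Vec (m i))
    (hsol : IsClosedLoop A K G T q v qh vh θh)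
    (hinit : ∀ i j, G.Adj i j → ‖q i 0 - q j 0‖ ≤ r - ε)
    (hβ : ∑ i, ‖(A i).θ - θh i 0‖ ^ 2 / (2 * K.β i)
      < K.ψ (r - 2 * ε / 3) - totalPot G K.ψ (fun i => q i 0)) :
    -- the estimates stay in the box and the actuators never saturate
    (∀ i, ∀ t ≥ 0, ∀ l, θh i t l ∈ Icc (K.θlo i l) (K.θup i l)) ∧
    (∀ i, ∀ t ≥ 0, ∀ l,
      |designedForce A K i (q i t) (qh i t) (v i t) (vh i t) (θh i t) l| ≤ (A i).fmax l) ∧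
    -- every agent stays close to its proxy, and the initial links are preserved
    (∀ i, ∀ t ≥ 0, ‖q i t - qh i t‖ < ε / 3) ∧
    (∀ i j, G.Adj i j → ∀ t ≥ 0, ‖qh i t - qh j t‖ < r - 2 * ε / 3) ∧
    (∀ i j, G.Adj i j → ∀ t ≥ 0, ‖q i t - q j t‖ < r) ∧
    -- consensus
    (∀ i, Tendsto (fun t => q i t - qh i t) atTop (𝓝 0)) ∧
    (∀ i, Tendsto (vh i) atTop (𝓝 0)) ∧
    (∀ i j, Tendsto (fun t => q i t - q j t) atTop (𝓝 0)) := by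
  set ρ := ε / 3 with hρ
  set rhat := r - 2 * ε / 3 with hrhat
  have hb : ∀ i l, 0 < satBound A K i l := fun i l => sub_pos.2 (hηf i l)
  have hb' : ∀ i l, 0 ≤ satBound A K i l := fun i l => (hb i l).le
  have hTbar : ∀ i j, G.Adj i j → 0 ≤ Tbar i j := fun i j hij =>
    (hT i j hij 0 le_rfl).1.trans (hT i j hij 0 le_rfl).2
  have hlip := abs_potForce_sub_le hψ hD₀ hϑ.le hgrad
  have hκ : 0 ≤ (ζ + n * ϑ) / (2 * a) := by positivity
  set W := totalEnergy A K G ((ζ + n * ϑ) / (2 * a)) Tbar q v qh vh θh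
  have hWzero : W 0 < K.ψ rhat :=
    (totalEnergy_zero hsol hTbar).trans_lt (lt_sub_iff_add_lt.1 hβ)
  have hdelay : ∀ t ≥ 0, (∀ s ≥ 0, s ≤ t → Confined A K G lam₁ ρ rhat q v qh vh s) →
      ∀ i j, G.Adj i j → ‖qh i t - qh j (t - T j i t)‖ ≤ D := fun t ht hc i j hij =>
    hsol.norm_sub_delayed_le ht hc hij (hT j i hij.symm t ht) (hD j i hij.symm)
  have hforce : ∀ t ≥ 0, Confined A K G lam₁ ρ rhat q v qh vh t → ∀ i l,
      |designedForce A K i (q i t) (qh i t) (v i t) (vh i t) (θh i t) l| ≤ (A i).fmax l :=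
    fun t ht hc => hsol.abs_designedForce_le hK hvmax hvhmax hη hb' ht hc
  have hdiss : ∀ t ≥ 0, (∀ s ≥ 0, s ≤ t → Confined A K G lam₁ ρ rhat q v qh vh s) →
      ∃ d ≤ -dissipation A K υ q qh vh t, HasDerivWithinAt W d (Ici 0) t := fun t ht hc =>
    exists_hasDerivWithinAt_totalEnergy hsol hEL hK hθ hψ hD₀ hζ.le hϑ.le ha hlip hk ht
      (fun i j hij => hT i j hij t ht) (hforce t ht (hc t ht le_rfl)) (hc t ht le_rfl).dist_le
      (hdelay t ht hc)
  -- at the first violation of strict confinement, the energy would still be below `ψ rhat`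
  have hstrict : ∀ t ≥ 0, StrictlyConfined A K G lam₁ ρ rhat q v qh vh t := by
    refine forall_nonneg_of_first_exit (fun t ht hc => hc.eventually hsol ht) fun t ht hbefore => ?_
    rcases ht.eq_or_lt with rfl | htpos
    · have h0 : ∀ i, qh i 0 = q i 0 := fun i => hsol.proxy_history i 0 le_rfl
      refine Confined.strictlyConfined hsol hEL hK hb' hκ hTbar hψ hψmax (fun i => ?_)
        (fun i j hij => ?_) hWzero
      · rw [h0, sub_self, norm_zero]; positivity
      · rw [h0, h0]; linarith [hinit i j hij]
    · have hlast : Confined A K G lam₁ ρ rhat q v qh vh t :=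
        Confined.of_forall_lt hsol htpos fun s hs hst => (hbefore s hs hst).confined
      have hall : ∀ s ≥ 0, s ≤ t → Confined A K G lam₁ ρ rhat q v qh vh s := fun s hs hst =>
        hst.eq_or_lt.elim (fun h => h ▸ hlast) fun h => (hbefore s hs h).confined
      have hd : ∀ s ∈ Icc 0 t, ∃ d ≤ 0, HasDerivWithinAt W d (Ici 0) s := fun s hs => by
        obtain ⟨d, hd, hder⟩ := hdiss s hs.1 fun s' hs' hs's => hall s' hs' (hs's.trans hs.2)
        exact ⟨d, hd.trans (neg_nonpos.2 (dissipation_nonneg hK hb' hυ s)), hder⟩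
      have hanti := antitoneOn_of_exists_hasDerivWithinAt_nonpos le_rfl
        (fun s hs => by
          obtain ⟨d, -, hder⟩ := hd s hs
          exact hder.continuousWithinAt.mono Icc_subset_Ici_self)
        (fun s hs => hd s (Ioo_subset_Icc_self hs))
        (left_mem_Icc.2 ht) (right_mem_Icc.2 ht) ht
      exact Confined.strictlyConfined hsol hEL hK hb' hκ hTbar hψ hψmax hlast.err_le hlast.dist_le
        (hanti.trans_lt hWzero)
  have hconf : ∀ t ≥ 0, Confined A K G lam₁ ρ rhat q v qh vh t := fun t ht =>
    (hstrict t ht).confined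
  have hdel : ∀ i j, G.Adj i j → ∀ t ≥ 0, ‖qh i t - qh j (t - T j i t)‖ ≤ D :=
    fun i j hij t ht => hdelay t ht (fun s hs _ => hconf s hs) i j hij
  have hW : ∀ t ≥ 0, ∃ d ≤ -dissipation A K υ q qh vh t, HasDerivWithinAt W d (Ici 0) t :=
    fun t ht => hdiss t ht fun s hs _ => hconf s hs
  have hW0 : ∀ t ≥ 0, 0 ≤ W t := fun t ht =>
    (energies_le_totalEnergy hsol hEL hK hb' hκ hTbar hψ (hconf t ht).dist_le).1
  have herr := tendsto_err hsol hK hb hυ hconf hW0 hW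
  have hvel := tendsto_proxyVel hsol hK hb' hυ hψ hζ.le hϑ.le hlip hconf hdel hW0 hW
  have hprox : ∀ i j, Tendsto (fun t => qh i t - qh j t) atTop (𝓝 0) := by
    refine tendsto_sub_of_proxy_dynamics hG hψ hD₀ hζ.le hϑ.le hlip (fun i j hij => hT i j hij)
      hsol.hasDerivAt_proxy (fun i t ht => hsol.hasDerivWithinAt_velExt i ht)
      (fun i j hij t ht => (hconf t ht).dist_le i j hij) hdel
      (fun i t => (hconf _ (le_max_right t 0)).vel_le i)
      (fun i => (hvel i).congr' ?_) fun i => ?_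
    · filter_upwards [eventually_ge_atTop 0] with t ht
      rw [max_eq_left ht]
    · have h1 := ((herr i).const_smul (K.p i)).norm
      rw [smul_zero, norm_zero] at h1
      exact squeeze_zero_norm (fun t => norm_Sat_le (hb' i) _) h1
  refine ⟨hsol.estimate_mem hK, fun i t ht => hforce t ht (hconf t ht) i,
    fun i t ht => (hstrict t ht).err_lt i, fun i j hij t ht => (hstrict t ht).dist_lt i j hij,
    fun i j hij t ht => ?_, herr, hvel, fun i j => ?_⟩
  · have h1 := (hstrict t ht).err_lt i
    have h2 := (hstrict t ht).err_lt j
    have h3 := (hstrict t ht).dist_lt i j hij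
    calc ‖q i t - q j t‖
        = ‖(q i t - qh i t) - (q j t - qh j t) + (qh i t - qh j t)‖ := by congr 1; abel
      _ ≤ ‖q i t - qh i t‖ + ‖q j t - qh j t‖ + ‖qh i t - qh j t‖ :=
          (norm_add_le _ _).trans (add_le_add_left (norm_sub_le _ _) _)
      _ < r := by linarith
  · have h1 := ((herr i).sub (herr j)).add (hprox i j)
    simp only [sub_zero, add_zero] at h1
    exact h1.congr fun t => by abel
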